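/- A group is called quasicyclic (a Prüfer group) if it is an infinite locally cyclic $p$-group for some prime $p$. Let $G$ be a group and let $A$, $B$ be subgroups of $G$ with $G=AB=\{ab \mid a\in A,\ b\in B\}$, such that each of $A$ and $B$ is either abelian or has a quasicyclic subgroup of index $2$. Then $G$ is soluble of derived length at most $3$. Moreover, if $B$ is non-abelian and $X$ is its quasicyclic subgroup, then $AX=XA$ is a metabelian subgroup of $G$ of index at most $2$; more precisely, $AX$ has index $2$ in $G$ if $A\cap B\le X$, and $AX=G$ otherwise. -/

import Mathlib

open scoped Pointwise

/-- A quasicyclic (Prüfer) group: an infinite locally cyclic `p`-group for some prime `p`, where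
locally cyclic means that every finitely generated subgroup is cyclic. -/
def IsQuasicyclic (H : Type*) [Group H] : Prop :=
  ∃ p : ℕ, p.Prime ∧ IsPGroup p H ∧ Infinite H ∧ ∀ K : Subgroup H, K.FG → IsCyclic K

/-- The group `H` is abelian or has a quasicyclic subgroup of index `2`. -/
def IsAbelianOrQuasicyclicIndexTwo (H : Type*) [Group H] : Prop :=
  IsMulCommutative H ∨ ∃ X : Subgroup H, IsQuasicyclic X ∧ X.index = 2

/-- A metabelian group: a group whose second derived subgroup is trivial. -/
def IsMetabelian (H : Type*) [Group H] : Prop :=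
  derivedSeries H 2 = ⊥

/-!
A non-abelian group `B` with a quasicyclic subgroup `X` of index two has its elements outside `X`
inverting `X`. The heart of the matter is `XA ⊆ AX` when `A ∩ B ≤ X`. Factoring out a normal
subgroup `N` maximal with `AN ∩ B ≤ X`, one may assume that every nontrivial normal subgroup `M`
has an element of `B \ X` in `AM`. Apart from easy cases, and possibly after interchanging `A` and
`B`, this forces `A ∩ B = 1` and makes the elements of `B \ X` involutions. Consider then which of
the elements `wc` with `w ∈ X` lie in `A(B \ X)`, for a fixed `c ∈ A`. Among elements `c` in
distinct cosets of the normalizer of some `⟨v⟩ ≤ X` at most two satisfy `wc ∈ A(B \ X)`, for almost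
all `w`. If `wc` lies in `A(B \ X)` for infinitely many `w` and outside for infinitely many `w`,
this yields a relation between two five-element sets that holds at least three times in each row
and at most twice in each column, which is impossible. Hence `wc` lies in `AX` for almost all `w`,
and finally for all `w`.

So `AX` is a subgroup of index at most two, and it is metabelian: by Itô's theorem if `A` is
abelian, and otherwise because a product of two quasicyclic groups is abelian.
-/

open scoped commutatorElement

section Quasicyclic

variable {G : Type*} [Group G]

theorem zpow_mem_zpowers_or_zpow_mem_zpowers {p : ℕ} (hp : p.Prime) {g : G} {n : ℕ}
    (hg : g ^ p ^ n = 1) (k l : ℤ) :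
    g ^ k ∈ Subgroup.zpowers (g ^ l) ∨ g ^ l ∈ Subgroup.zpowers (g ^ k) := by
  have hg' : IsOfFinOrder g := isOfFinOrder_iff_pow_eq_one.2 ⟨p ^ n, pow_pos hp.pos n, hg⟩
  have key (k : ℤ) : ∃ i : ℕ, Subgroup.zpowers (g ^ k) = Subgroup.zpowers (g ^ p ^ i) := by
    obtain ⟨m, hm⟩ : ∃ m : ℕ, g ^ m = g ^ k := hg'.mem_powers_iff_mem_zpowers.2 ⟨k, rfl⟩
    rw [← hm]
    rcases eq_or_ne m 0 with rfl | hm0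
    · exact ⟨n, by rw [hg, pow_zero]⟩
    · obtain ⟨i, r, hr, rfl⟩ := Nat.exists_eq_pow_mul_and_not_dvd hm0 p hp.ne_one
      refine ⟨i, le_antisymm (Subgroup.zpowers_le.2 ⟨r, by simp [pow_mul]⟩)
        (Subgroup.zpowers_le.2 ?_)⟩
      have hdvd : orderOf (g ^ p ^ i) ∣ p ^ n :=
        orderOf_dvd_of_pow_eq_one (by rw [pow_right_comm, hg, one_pow])
      rw [pow_mul, mem_zpowers_pow_iff]
      exact (((hp.coprime_iff_not_dvd.2 hr).pow_left n).coprime_dvd_left hdvd).symm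
  obtain ⟨i, hi⟩ := key k
  obtain ⟨j, hj⟩ := key l
  rw [← Subgroup.zpowers_le, ← Subgroup.zpowers_le, hi, hj]
  rcases le_total i j with hij | hij
  · exact .inr (Subgroup.zpowers_le.2 ⟨(p ^ (j - i) : ℕ), by
      simp only [zpow_natCast, ← pow_mul, ← pow_add, Nat.add_sub_cancel' hij]⟩)
  · exact .inl (Subgroup.zpowers_le.2 ⟨(p ^ (i - j) : ℕ), by
      simp only [zpow_natCast, ← pow_mul, ← pow_add, Nat.add_sub_cancel' hij]⟩)

namespace IsQuasicyclic

theorem exists_mem_zpowers (hG : IsQuasicyclic G) (x y : G) :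
    ∃ g : G, x ∈ Subgroup.zpowers g ∧ y ∈ Subgroup.zpowers g := by
  obtain ⟨-, -, -, -, hcyc⟩ := hG
  obtain ⟨g, hg⟩ := (Subgroup.isCyclic_iff_exists_zpowers_eq_top _).1
    (hcyc (Subgroup.closure {x, y}) ((Subgroup.fg_iff _).2 ⟨{x, y}, rfl, by simp⟩))
  exact ⟨g, hg ▸ Subgroup.subset_closure (by simp), hg ▸ Subgroup.subset_closure (by simp)⟩

theorem isMulCommutative (hG : IsQuasicyclic G) : IsMulCommutative G := by
  refine ⟨⟨fun x y => ?_⟩⟩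
  obtain ⟨g, ⟨k, rfl⟩, l, rfl⟩ := hG.exists_mem_zpowers x y
  exact (Commute.refl g).zpow_zpow k l

theorem mem_zpowers_or_mem_zpowers (hG : IsQuasicyclic G) (x y : G) :
    x ∈ Subgroup.zpowers y ∨ y ∈ Subgroup.zpowers x := by
  obtain ⟨g, ⟨k, rfl⟩, l, rfl⟩ := hG.exists_mem_zpowers x y
  obtain ⟨p, hp, hpG, -, -⟩ := hG
  obtain ⟨n, hn⟩ := hpG g
  exact zpow_mem_zpowers_or_zpow_mem_zpowers hp hn k l

theorem isOfFinOrder (hG : IsQuasicyclic G) (x : G) : IsOfFinOrder x := by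
  obtain ⟨p, hp, hpG, -, -⟩ := hG
  obtain ⟨n, hn⟩ := hpG x
  exact isOfFinOrder_iff_pow_eq_one.2 ⟨p ^ n, pow_pos hp.pos n, hn⟩

theorem finite_of_ne_top (hG : IsQuasicyclic G) {H : Subgroup G} (hH : H ≠ ⊤) : Finite H := by
  obtain ⟨x, -, hxH⟩ := SetLike.exists_of_lt hH.lt_top
  refine (finite_zpowers.2 (hG.isOfFinOrder x)).subset fun y hy => ?_
  exact (hG.mem_zpowers_or_mem_zpowers y x).resolve_right
    fun h => hxH (Subgroup.zpowers_le.2 hy h)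

variable {H : Type*} [Group H]

theorem of_surjective (hG : IsQuasicyclic G) [Nontrivial H] {f : G →* H}
    (hf : Function.Surjective f) : IsQuasicyclic H := by
  have hker : Finite f.ker := by
    refine hG.finite_of_ne_top fun h => ?_
    obtain ⟨y, hy⟩ := exists_ne (1 : H)
    obtain ⟨x, rfl⟩ := hf y
    exact hy (f.mem_ker.1 (h ▸ Subgroup.mem_top x))
  obtain ⟨p, hp, hpG, hinf, hcyc⟩ := hG
  refine ⟨p, hp, hpG.of_surjective f hf, ?_, ?_⟩
  · refine not_finite_iff_infinite.1 fun _ => not_finite_iff_infinite.2 hinf ?_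
    have := Finite.of_equiv H (QuotientGroup.quotientKerEquivOfSurjective f hf).symm.toEquiv
    exact Finite.of_subgroup_quotient f.ker
  · rintro K ⟨S, rfl⟩
    have hS : (f.comp (Subgroup.closure (Function.surjInv hf '' S)).subtype).range =
        Subgroup.closure (S : Set H) := by
      rw [MonoidHom.range_comp, Subgroup.range_subtype, MonoidHom.map_closure, Set.image_image]
      simp only [Function.surjInv_eq, Set.image_id']
    have := hcyc _ ((Subgroup.fg_iff _).2 ⟨_, rfl, S.finite_toSet.image (Function.surjInv hf)⟩)
    rw [← hS]
    exact isCyclic_of_surjective _ (MonoidHom.rangeRestrict_surjective _)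

theorem range (hG : IsQuasicyclic G) {f : G →* H} (hf : f ≠ 1) : IsQuasicyclic f.range :=
  have : Nontrivial f.range :=
    f.range.nontrivial_iff_ne_bot.2 fun h => hf (MonoidHom.range_eq_bot_iff.1 h)
  hG.of_surjective f.rangeRestrict_surjective

theorem hom_eq_one (hG : IsQuasicyclic G) [Finite H] (f : G →* H) : f = 1 := by
  by_contra hf
  obtain ⟨-, -, -, hinf, -⟩ := hG.range hf
  exact not_finite_iff_infinite.2 hinf inferInstance

theorem surjective_of_ne_one (hG : IsQuasicyclic G) {f : G →* G} (hf : f ≠ 1) :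
    Function.Surjective f := by
  rw [← MonoidHom.range_eq_top]
  by_contra htop
  obtain ⟨-, -, -, hinf, -⟩ := hG.range hf
  exact not_finite_iff_infinite.2 hinf (hG.finite_of_ne_top htop)

variable {X : Subgroup G}

theorem infinite_coe (hX : IsQuasicyclic X) : (X : Set G).Infinite := by
  obtain ⟨-, -, -, hinf, -⟩ := hX
  exact Set.infinite_coe_iff.1 hinf

theorem commute (hX : IsQuasicyclic X) {x y : G} (hx : x ∈ X) (hy : y ∈ X) : Commute x y :=
  congrArg Subtype.val (hX.isMulCommutative.is_comm.comm ⟨x, hx⟩ ⟨y, hy⟩)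

theorem isOfFinOrder_of_mem (hX : IsQuasicyclic X) {x : G} (hx : x ∈ X) : IsOfFinOrder x :=
  Submonoid.isOfFinOrder_coe.2 (hX.isOfFinOrder ⟨x, hx⟩)

theorem mem_zpowers_or_mem_zpowers_of_mem (hX : IsQuasicyclic X) {x y : G} (hx : x ∈ X)
    (hy : y ∈ X) : x ∈ Subgroup.zpowers y ∨ y ∈ Subgroup.zpowers x :=
  (hX.mem_zpowers_or_mem_zpowers ⟨x, hx⟩ ⟨y, hy⟩).imp
    (fun ⟨k, hk⟩ => ⟨k, congrArg Subtype.val hk⟩) fun ⟨k, hk⟩ => ⟨k, congrArg Subtype.val hk⟩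

theorem mem_zpowers_of_orderOf_le (hX : IsQuasicyclic X) {x y : G} (hx : x ∈ X) (hy : y ∈ X)
    (hxy : orderOf x ≤ orderOf y) : x ∈ Subgroup.zpowers y := by
  rcases hX.mem_zpowers_or_mem_zpowers_of_mem hx hy with h | h
  · exact h
  · have : Finite (Subgroup.zpowers x) := (hX.isOfFinOrder_of_mem hx).finite_zpowers
    rw [Subgroup.eq_of_le_of_card_ge (Subgroup.zpowers_le.2 h)
      (by rwa [Nat.card_zpowers, Nat.card_zpowers])]
    exact Subgroup.mem_zpowers x

theorem le_total (hX : IsQuasicyclic X) {H K : Subgroup G} (hH : H ≤ X) (hK : K ≤ X) :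
    H ≤ K ∨ K ≤ H := by
  by_contra! hc
  obtain ⟨x, hx, hxK⟩ := SetLike.not_le_iff_exists.1 hc.1
  obtain ⟨y, hy, hyH⟩ := SetLike.not_le_iff_exists.1 hc.2
  rcases hX.mem_zpowers_or_mem_zpowers_of_mem (hH hx) (hK hy) with h | h
  · exact hxK (Subgroup.zpowers_le.2 hy h)
  · exact hyH (Subgroup.zpowers_le.2 hx h)

theorem finite_of_notMem (hX : IsQuasicyclic X) {H : Subgroup G} (hH : H ≤ X) {x : G} (hx : x ∈ X)
    (hxH : x ∉ H) : (H : Set G).Finite :=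
  (finite_zpowers.2 (hX.isOfFinOrder_of_mem hx)).subset <|
    (hX.le_total hH (Subgroup.zpowers_le.2 hx)).resolve_right
      fun h => hxH (h (Subgroup.mem_zpowers x))

theorem eq_of_infinite (hX : IsQuasicyclic X) {H : Subgroup G} (hH : H ≤ X)
    (hinf : (H : Set G).Infinite) : H = X :=
  le_antisymm hH fun _ hx => of_not_not fun hxH => hinf (hX.finite_of_notMem hH hx hxH)

theorem finite_setOf_pow_eq_one (hX : IsQuasicyclic X) {n : ℕ} (hn : 0 < n) :
    {x ∈ X | x ^ n = 1}.Finite := by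
  have horder (m : ℕ) : {x ∈ X | orderOf x = m}.Finite := by
    rcases Set.eq_empty_or_nonempty {x ∈ X | orderOf x = m} with h | ⟨x, hx, rfl⟩
    · exact h ▸ Set.finite_empty
    · exact (finite_zpowers.2 (hX.isOfFinOrder_of_mem hx)).subset
        fun y hy => hX.mem_zpowers_of_orderOf_le hy.1 hx hy.2.le
  refine ((Set.finite_Iic n).biUnion fun m _ => horder m).subset fun x hx => ?_
  exact Set.mem_biUnion (orderOf_le_of_pow_eq_one hn hx.2) ⟨hx.1, rfl⟩

theorem exists_pow_eq (hX : IsQuasicyclic X) {n : ℕ} (hn : 0 < n) {x : G} (hx : x ∈ X) :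
    ∃ u ∈ X, u ^ n = x := by
  let _ : CommGroup X := { mul_comm := hX.isMulCommutative.is_comm.comm }
  have hne : powMonoidHom n ≠ (1 : X →* X) := fun h =>
    hX.infinite_coe ((hX.finite_setOf_pow_eq_one hn).subset fun y hy =>
      ⟨hy, congrArg Subtype.val (show (⟨y, hy⟩ : X) ^ n = 1 from DFunLike.congr_fun h _)⟩)
  obtain ⟨u, hu⟩ := hX.surjective_of_ne_one hne ⟨x, hx⟩
  exact ⟨u, u.2, congrArg Subtype.val hu⟩

theorem map (hX : IsQuasicyclic X) {f : G →* H} (hf : ¬ X ≤ f.ker) : IsQuasicyclic (X.map f) := by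
  have : Nontrivial (X.map f) :=
    (Subgroup.nontrivial_iff_ne_bot _).2 fun h => hf ((Subgroup.map_eq_bot_iff X).1 h)
  exact hX.of_surjective (f.subgroupMap_surjective X)

theorem subgroupOf (hX : IsQuasicyclic X) {K : Subgroup G} (hXK : X ≤ K) :
    IsQuasicyclic (X.subgroupOf K) := by
  have e := Subgroup.subgroupOfEquivOfLe hXK
  have : Nontrivial (X.subgroupOf K) := by
    obtain ⟨-, -, -, _, -⟩ := hX
    exact e.toEquiv.nontrivial
  exact hX.of_surjective (f := e.symm.toMonoidHom) e.symm.surjective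

theorem commute_of_le_normalizer (hX : IsQuasicyclic X) {N : Subgroup G} [Finite N]
    (hXN : X ≤ Subgroup.normalizer (N : Set G)) {x n : G} (hx : x ∈ X) (hn : n ∈ N) :
    Commute x n := by
  have : Finite (MulAut N) :=
    Finite.of_injective (fun e : MulAut N => (e : N → N)) DFunLike.coe_injective
  have h := DFunLike.congr_fun
    (hX.hom_eq_one (N.normalizerMonoidHom.comp (Subgroup.inclusion hXN))) ⟨x, hx⟩
  have h' := congrArg Subtype.val (DFunLike.congr_fun h ⟨n, hn⟩)
  exact mul_inv_eq_iff_eq_mul.1 h'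

theorem conj_eq_inv_of_index_two (hX : IsQuasicyclic X) (hX2 : X.index = 2)
    (hG : ¬ IsMulCommutative G) {x y : G} (hy : y ∉ X) (hx : x ∈ X) : y * x * y⁻¹ = x⁻¹ := by
  have := Subgroup.normal_of_index_eq_two hX2
  let _ : CommGroup X := { mul_comm := hX.isMulCommutative.is_comm.comm }
  let φ : X →* X := MonoidHom.id X * (MulAut.conjNormal y).toMonoidHom
  have hφ (u : X) : (φ u : G) = u * (y * u * y⁻¹) := rfl
  rcases eq_or_ne φ 1 with h1 | h1
  · have h := hφ ⟨x, hx⟩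
    rw [h1] at h
    exact (inv_eq_of_mul_eq_one_right h.symm).symm
  have hyX (u : G) (hu : u ∈ X) : Commute y u := by
    obtain ⟨v, hv⟩ := hX.surjective_of_ne_one h1 ⟨u, hu⟩
    obtain rfl : v * (y * v * y⁻¹) = u := by rw [← hφ, hv]
    have hyv : y * v * y⁻¹ ∈ X := this.conj_mem v v.2 y
    have hy2 : y * y ∈ X := (Subgroup.mul_mem_iff_of_index_two hX2).2 Iff.rfl
    refine mul_inv_eq_iff_eq_mul.1 ?_
    calc y * (v * (y * v * y⁻¹)) * y⁻¹ = y * v * y⁻¹ * (y * y * v * (y * y)⁻¹) := by group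
      _ = v * (y * v * y⁻¹) := by
        rw [mul_inv_eq_of_eq_mul (hX.commute hy2 v.2), hX.commute hyv v.2]
  refine absurd ?_ hG
  have hcenter : (QuotientGroup.mk' X).ker ≤ Subgroup.center G := by
    rw [QuotientGroup.ker_mk']
    refine fun u hu => Subgroup.mem_center_iff.2 fun g => ?_
    by_cases hg : g ∈ X
    · exact hX.commute hg hu
    · have hgy : g * y ∈ X := (Subgroup.mul_mem_iff_of_index_two hX2).2 (iff_of_false hg hy)
      have h : Commute (g * y * y⁻¹) u := (hX.commute hgy hu).mul_left (hyX u hu).inv_left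
      rwa [mul_inv_cancel_right] at h
  have : IsCyclic (G ⧸ X) := isCyclic_of_prime_card (p := 2) hX2
  exact MonoidHom.isMulCommutative_of_isCyclic_of_ker_le_center _ hcenter

end IsQuasicyclic

end Quasicyclic

theorem mul_mem_iff_of_relIndex_two {G : Type*} [Group G] {B X : Subgroup G} (hX : X.relIndex B = 2)
    {b c : G} (hb : b ∈ B) (hc : c ∈ B) :
    b * c ∈ X ↔ (b ∈ X ↔ c ∈ X) :=
  Subgroup.mul_mem_iff_of_index_two hX (a := ⟨b, hb⟩) (b := ⟨c, hc⟩)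

theorem apply_mem_map_iff {G H : Type*} [Group G] [Group H] {f : G →* H} {B X : Subgroup G}
    (hXB : X ≤ B) (hB : B ⊓ f.ker ≤ X) {b : G} (hb : b ∈ B) : f b ∈ X.map f ↔ b ∈ X := by
  refine ⟨fun ⟨x, hx, hxb⟩ => ?_, fun hbX => ⟨b, hbX, rfl⟩⟩
  refine (X.mul_mem_cancel_left (X.inv_mem hx)).1 (hB ⟨B.mul_mem (B.inv_mem (hXB hx)) hb, ?_⟩)
  change f (x⁻¹ * b) = 1
  rw [map_mul, map_inv, hxb, inv_mul_cancel]

/-- The pair `X ≤ B` is of locally dihedral or locally quaternion type: `X` is a quasicyclic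
subgroup of index two in `B`, inverted by the elements of `B` outside `X`. These are exactly the
non-abelian groups with a quasicyclic subgroup of index two. -/
structure IsDihedralType {G : Type*} [Group G] (B X : Subgroup G) : Prop where
  isQuasicyclic : IsQuasicyclic X
  le : X ≤ B
  relIndex : X.relIndex B = 2
  conj_eq_inv : ∀ y ∈ B, y ∉ X → ∀ x ∈ X, y * x * y⁻¹ = x⁻¹

namespace IsDihedralType

variable {G : Type*} [Group G] {B X : Subgroup G}

theorem exists_notMem (h : IsDihedralType B X) : ∃ y ∈ B, y ∉ X := by
  by_contra! hBX
  have := h.relIndex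
  simp [Subgroup.relIndex_eq_one.2 hBX] at this

theorem mul_mem (h : IsDihedralType B X) {y z : G} (hy : y ∈ B) (hyX : y ∉ X) (hz : z ∈ B)
    (hzX : z ∉ X) : y * z ∈ X :=
  (mul_mem_iff_of_relIndex_two h.relIndex hy hz).2 (iff_of_false hyX hzX)

theorem sq_mem (h : IsDihedralType B X) {b : G} (hb : b ∈ B) : b ^ 2 ∈ X := by
  rw [pow_two, mul_mem_iff_of_relIndex_two h.relIndex hb hb]

theorem inv_conj_eq_inv (h : IsDihedralType B X) {y x : G} (hy : y ∈ B) (hyX : y ∉ X)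
    (hx : x ∈ X) : y⁻¹ * x * y = x⁻¹ := by
  simpa using h.conj_eq_inv y⁻¹ (B.inv_mem hy) (mt X.inv_mem_iff.1 hyX) x hx

theorem conj_eq_or_eq_inv (h : IsDihedralType B X) {b : G} (hb : b ∈ B) :
    (∀ x ∈ X, b * x * b⁻¹ = x) ∨ ∀ x ∈ X, b * x * b⁻¹ = x⁻¹ := by
  by_cases hbX : b ∈ X
  · exact .inl fun x hx => mul_inv_eq_of_eq_mul (h.isQuasicyclic.commute hbX hx)
  · exact .inr (h.conj_eq_inv b hb hbX)

theorem conj_mem (h : IsDihedralType B X) {b x : G} (hb : b ∈ B) (hx : x ∈ X) :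
    b * x * b⁻¹ ∈ X := by
  rcases h.conj_eq_or_eq_inv hb with hb | hb
  · exact (hb x hx).symm ▸ hx
  · exact (hb x hx).symm ▸ X.inv_mem hx

theorem sq_eq_sq (h : IsDihedralType B X) {y z : G} (hy : y ∈ B) (hyX : y ∉ X) (hz : z ∈ B)
    (hzX : z ∉ X) : y ^ 2 = z ^ 2 := by
  have hx : z⁻¹ * y ∈ X := h.mul_mem (B.inv_mem hz) (mt X.inv_mem_iff.1 hzX) hy hyX
  calc y ^ 2 = z ^ 2 * (z⁻¹ * (z⁻¹ * y) * z * (z⁻¹ * y)) := by rw [pow_two, pow_two]; group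
    _ = z ^ 2 := by rw [h.inv_conj_eq_inv hz hzX hx, inv_mul_cancel, mul_one]

theorem sq_mul_self (h : IsDihedralType B X) {y : G} (hy : y ∈ B) (hyX : y ∉ X) :
    y ^ 2 * y ^ 2 = 1 := by
  have := h.conj_eq_inv y hy hyX (y ^ 2) (h.sq_mem hy)
  rw [show y * y ^ 2 * y⁻¹ = y ^ 2 by group] at this
  exact mul_eq_one_iff_eq_inv.2 this

theorem of_not_isMulCommutative (hX : IsQuasicyclic X) (hXB : X ≤ B) (hX2 : X.relIndex B = 2)
    (hB : ¬ IsMulCommutative B) : IsDihedralType B X :=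
  ⟨hX, hXB, hX2, fun y hy hyX x hx => congrArg Subtype.val
    ((hX.subgroupOf hXB).conj_eq_inv_of_index_two hX2 hB (x := ⟨x, hXB hx⟩) (y := ⟨y, hy⟩) hyX hx)⟩

theorem not_isMulCommutative (h : IsDihedralType B X) : ¬ IsMulCommutative B := by
  intro hB
  obtain ⟨y, hy, hyX⟩ := h.exists_notMem
  refine h.isQuasicyclic.infinite_coe
    ((h.isQuasicyclic.finite_setOf_pow_eq_one two_pos).subset fun x hx => ⟨hx, ?_⟩)
  have hxy : y * x = x * y :=
    congrArg Subtype.val (hB.is_comm.comm ⟨y, hy⟩ ⟨x, h.le hx⟩)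
  have := h.conj_eq_inv y hy hyX x hx
  rw [hxy, mul_inv_cancel_right] at this
  rw [pow_two]
  exact mul_eq_one_iff_eq_inv.2 this

theorem eq_of_isQuasicyclic (h : IsDihedralType B X) {Z : Subgroup G} (hZ : IsQuasicyclic Z)
    (hZB : Z ≤ B) : Z = X := by
  refine h.isQuasicyclic.eq_of_infinite (fun z hz => ?_) hZ.infinite_coe
  obtain ⟨u, hu, rfl⟩ := hZ.exists_pow_eq two_pos hz
  exact h.sq_mem (hZB hu)

section Map

variable {H : Type*} [Group H]

theorem map (h : IsDihedralType B X) {f : G →* H} (hX : ¬ X ≤ f.ker) (hB : B ⊓ f.ker ≤ X) :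
    IsDihedralType (B.map f) (X.map f) := by
  have mem_iff {b : G} (hb : b ∈ B) : f b ∈ X.map f ↔ b ∈ X := apply_mem_map_iff h.le hB hb
  refine ⟨h.isQuasicyclic.map hX, Subgroup.map_mono h.le, ?_, ?_⟩
  · obtain ⟨y, hy, hyX⟩ := h.exists_notMem
    refine Subgroup.relIndex_eq_two_iff.2 ⟨f y, ⟨y, hy, rfl⟩, ?_⟩
    rintro _ ⟨b, hb, rfl⟩
    rw [← map_mul, mem_iff (B.mul_mem hb hy), mem_iff hb,
      mul_mem_iff_of_relIndex_two h.relIndex hb hy]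
    by_cases hbX : b ∈ X <;> simp [hbX, hyX]
  · rintro _ ⟨y, hy, rfl⟩ hyX _ ⟨x, hx, rfl⟩
    simp only [← map_mul, ← map_inv, h.conj_eq_inv y hy (mt (mem_iff hy).2 hyX) x hx]

theorem subgroupOf (h : IsDihedralType B X) {K : Subgroup G} (hBK : B ≤ K) :
    IsDihedralType (B.subgroupOf K) (X.subgroupOf K) :=
  ⟨h.isQuasicyclic.subgroupOf (h.le.trans hBK), fun _ hx => h.le hx,
    (Subgroup.relIndex_subgroupOf hBK).trans h.relIndex,
    fun y hy hyX x hx => Subtype.ext (h.conj_eq_inv y hy hyX x hx)⟩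

end Map

end IsDihedralType

section Group

variable {G : Type*} [Group G]

theorem mem_normalizer_zpowers_iff {v g : G} (hv : IsOfFinOrder v) :
    g ∈ Subgroup.normalizer (Subgroup.zpowers v : Set G) ↔ g * v * g⁻¹ ∈ Subgroup.zpowers v := by
  refine ⟨fun hg => (Subgroup.mem_normalizer_iff.1 hg v).1 (Subgroup.mem_zpowers v), fun hg => ?_⟩
  have : Finite (Subgroup.zpowers v : Set G) := hv.finite_zpowers
  refine Subgroup.mem_normalizer_fintype ?_
  rintro _ ⟨k, rfl⟩
  simpa only [SetLike.mem_coe, conj_zpow] using Subgroup.zpow_mem _ hg k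

theorem mem_normalizer_zpowers_of_commute {v g : G} (hgv : Commute g v) :
    g ∈ Subgroup.normalizer (Subgroup.zpowers v : Set G) :=
  Subgroup.centralizer_le_normalizer _ <| by
    rintro _ ⟨k, rfl⟩
    exact (hgv.zpow_right k).eq.symm

variable {A B : Subgroup G}

theorem exists_mul_eq (hAB : (A : Set G) * (B : Set G) = Set.univ) (g : G) :
    ∃ a ∈ A, ∃ b ∈ B, a * b = g :=
  Set.mem_mul.1 (hAB ▸ Set.mem_univ g)

theorem eq_and_eq_of_mul_eq_mul (hAB : A ⊓ B = ⊥) {a a' b b' : G} (ha : a ∈ A) (ha' : a' ∈ A)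
    (hb : b ∈ B) (hb' : b' ∈ B) (h : a * b = a' * b') : a = a' ∧ b = b' := by
  have := Subgroup.mul_injective_of_disjoint (disjoint_iff.2 hAB) (a₁ := (⟨a, ha⟩, ⟨b, hb⟩))
    (a₂ := (⟨a', ha'⟩, ⟨b', hb'⟩)) h
  simpa using this

theorem exists_mul_eq' (hAB : (A : Set G) * (B : Set G) = Set.univ) (g : G) :
    ∃ b ∈ B, ∃ a ∈ A, b * a = g := by
  obtain ⟨a, ha, b, hb, hab⟩ := exists_mul_eq hAB g⁻¹
  exact ⟨b⁻¹, B.inv_mem hb, a⁻¹, A.inv_mem ha, by rw [← mul_inv_rev, hab, inv_inv]⟩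

theorem mul_eq_univ_symm (hAB : (A : Set G) * (B : Set G) = Set.univ) :
    (B : Set G) * (A : Set G) = Set.univ :=
  Set.eq_univ_of_forall fun g => Set.mem_mul.2 (exists_mul_eq' hAB g)

theorem finite_inf_of_mul_mem {Y H : Subgroup G}
    (hAY : ∀ a ∈ A, a ∉ Y → ∀ b ∈ A, b ∉ Y → a * b ∈ Y)
    (hY : ((Y ⊓ H : Subgroup G) : Set G).Finite) : ((A ⊓ H : Subgroup G) : Set G).Finite := by
  by_cases hAHY : A ⊓ H ≤ Y
  · exact hY.subset fun a ha => ⟨hAHY ha, ha.2⟩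
  · obtain ⟨c, hc, hcY⟩ := SetLike.not_le_iff_exists.1 hAHY
    refine (hY.union (hY.preimage (mul_left_injective c).injOn)).subset fun a ha => ?_
    by_cases haY : a ∈ Y
    · exact .inl ⟨haY, ha.2⟩
    · exact .inr ⟨hAY a ha.1 haY c hc.1 hcY, H.mul_mem ha.2 hc.2⟩

theorem finite_of_finite_inf (hAB : (A : Set G) * (B : Set G) = Set.univ) {M H : Subgroup G}
    (hMH : M ≤ H) (hBH : B ≤ H) (hA : ((A ⊓ H : Subgroup G) : Set G).Finite)
    (hB : ((B ⊓ M : Subgroup G) : Set G).Finite) : (M : Set G).Finite := by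
  choose α hα β hβ hαβ using exists_mul_eq hAB
  refine .of_finite_fibers α (hA.subset ?_) ?_
  · rintro _ ⟨m, hm, rfl⟩
    exact ⟨hα m, (H.mul_mem_cancel_right (hBH (hβ m))).1 ((hαβ m).symm ▸ hMH hm)⟩
  · rintro _ ⟨m, hm, rfl⟩
    refine (hB.preimage (mul_right_injective m⁻¹).injOn).subset ?_
    rintro n ⟨hn, hnm : α n = α m⟩
    have : m⁻¹ * n = (β m)⁻¹ * β n := by
      conv_lhs => rw [← hαβ m, ← hαβ n, hnm]
      group
    refine ⟨?_, M.mul_mem (M.inv_mem hm) hn⟩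
    change m⁻¹ * n ∈ B
    exact this ▸ B.mul_mem (B.inv_mem (hβ m)) (hβ n)

theorem mem_normalCore_of_forall_conj_mem (hAB : (A : Set G) * (B : Set G) = Set.univ)
    {K : Subgroup G} (hBK : B ≤ K) {s : G} (hs : ∀ a ∈ A, a * s * a⁻¹ ∈ K) : s ∈ K.normalCore := by
  intro g
  obtain ⟨b, hb, a, ha, rfl⟩ := exists_mul_eq' hAB g
  rw [show b * a * s * (b * a)⁻¹ = b * (a * s * a⁻¹) * b⁻¹ by group]
  exact K.mul_mem (K.mul_mem (hBK hb) (hs a ha)) (K.inv_mem (hBK hb))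

theorem isMulCommutative_normalClosure_singleton {v : G} (hv : ∀ g, Commute v (g * v * g⁻¹)) :
    IsMulCommutative (Subgroup.normalClosure {v}) := by
  refine Subgroup.isMulCommutative_closure fun x hx y hy => ?_
  simp only [Group.mem_conjugatesOfSet_iff, Set.mem_singleton_iff, exists_eq_left,
    isConj_iff] at hx hy
  obtain ⟨⟨g, rfl⟩, k, rfl⟩ := And.intro hx hy
  have := (Commute.conj_iff g).2 (hv (g⁻¹ * k))
  simpa [mul_assoc] using this.eq

theorem conj_mem_normalClosure_singleton (v g : G) :
    g * v * g⁻¹ ∈ Subgroup.normalClosure {v} :=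
  Subgroup.normalClosure_normal.conj_mem v
    (Subgroup.subset_normalClosure (Set.mem_singleton v)) g

theorem normalClosure_singleton_induction {v : G}
    {p : (k : G) → k ∈ Subgroup.normalClosure {v} → Prop}
    (conj : ∀ g, p (g * v * g⁻¹) (conj_mem_normalClosure_singleton v g))
    (one : p 1 (one_mem _))
    (mul : ∀ k l (hk : k ∈ Subgroup.normalClosure {v}) (hl : l ∈ Subgroup.normalClosure {v}),
      p k hk → p l hl → p (k * l) (mul_mem hk hl))
    (inv : ∀ k (hk : k ∈ Subgroup.normalClosure {v}), p k hk → p k⁻¹ (inv_mem hk)) {k : G}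
    (hk : k ∈ Subgroup.normalClosure {v}) : p k hk := by
  induction hk using Subgroup.closure_induction with
  | mem x hx =>
    obtain ⟨_, rfl, hvx⟩ := Group.mem_conjugatesOfSet_iff.1 hx
    obtain ⟨g, rfl⟩ := isConj_iff.1 hvx
    exact conj g
  | one => exact one
  | mul x y hx hy hpx hpy => exact mul x y hx hy hpx hpy
  | inv x hx hpx => exact inv x hx hpx

theorem pow_eq_one_of_mem_normalClosure {v : G} [IsMulCommutative (Subgroup.normalClosure {v})]
    {n : ℕ} (hv : v ^ n = 1) {k : G} (hk : k ∈ Subgroup.normalClosure {v}) : k ^ n = 1 := by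
  induction hk using normalClosure_singleton_induction with
  | conj g => simp [conj_pow, hv]
  | one => exact one_pow n
  | mul k l hk hl hkn hln =>
    rw [(show Commute k l from setLike_mul_comm hk hl).mul_pow, hkn, hln, one_mul]
  | inv k _ hkn => rw [inv_pow, hkn, inv_one]

theorem exists_pow_eq_of_mem_normalClosure {v : G} [IsMulCommutative (Subgroup.normalClosure {v})]
    {n : ℕ} {m : G} (hm : m ∈ Subgroup.normalClosure {v ^ n}) :
    ∃ k ∈ Subgroup.normalClosure {v}, k ^ n = m := by
  induction hm using normalClosure_singleton_induction with
  | conj g =>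
    exact ⟨g * v * g⁻¹, conj_mem_normalClosure_singleton v g, conj_pow⟩
  | one => exact ⟨1, one_mem _, one_pow n⟩
  | mul m m' _ _ hm hm' =>
    obtain ⟨⟨k, hk, rfl⟩, l, hl, rfl⟩ := And.intro hm hm'
    exact ⟨k * l, mul_mem hk hl, (show Commute k l from setLike_mul_comm hk hl).mul_pow n⟩
  | inv m _ hm =>
    obtain ⟨k, hk, rfl⟩ := hm
    exact ⟨k⁻¹, inv_mem hk, inv_pow k n⟩

end Group

/-- The set `A (B \ X)`; when `X` has index two in `B`, it is the part of `A B` which the product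
`A X` may miss. -/
def outerProduct {G : Type*} [Group G] (A B X : Subgroup G) : Set G :=
  (A : Set G) * ((B : Set G) \ X)

/-- An exact factorization `G = A B` in which `B` is locally dihedral, `A` is infinite and has a
subgroup `Y` of index at most two on which it acts by inversion or trivially, and `v ∈ X` generates
a subgroup which no nontrivial element of `Y` normalizes. -/
structure DihedralFactorization {G : Type*} [Group G] (A B X Y : Subgroup G) (v : G) : Prop where
  mul_eq_univ : (A : Set G) * (B : Set G) = Set.univ
  inf_eq_bot : A ⊓ B = ⊥
  infinite_left : (A : Set G).Infinite
  isDihedralType : IsDihedralType B X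
  sq_eq_one : ∀ y ∈ B, y ∉ X → y ^ 2 = 1
  mul_mem : ∀ a ∈ A, a ∉ Y → ∀ b ∈ A, b ∉ Y → a * b ∈ Y
  conj_eq_or_eq_inv : ∀ a ∈ A, (∀ k ∈ Y, a * k * a⁻¹ = k) ∨ ∀ k ∈ Y, a * k * a⁻¹ = k⁻¹
  mem : v ∈ X
  inf_normalizer : Y ⊓ Subgroup.normalizer (Subgroup.zpowers v : Set G) = ⊥

namespace DihedralFactorization

open Filter

variable {G : Type*} [Group G] {A B X Y : Subgroup G} {v : G}

theorem mul_mem_outerProduct_iff (h : DihedralFactorization A B X Y v) {a b : G} (ha : a ∈ A)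
    (hb : b ∈ B) : a * b ∈ outerProduct A B X ↔ b ∉ X := by
  refine ⟨?_, fun hbX => Set.mul_mem_mul ha ⟨hb, hbX⟩⟩
  rintro ⟨a', ha', b', ⟨hb', hbX'⟩, he⟩
  rwa [(eq_and_eq_of_mul_eq_mul h.inf_eq_bot ha ha' hb hb' he.symm).2]

theorem left_mul_mem_outerProduct_iff (h : DihedralFactorization A B X Y v) {a g : G}
    (ha : a ∈ A) : a * g ∈ outerProduct A B X ↔ g ∈ outerProduct A B X := by
  obtain ⟨a', ha', b, hb, rfl⟩ := exists_mul_eq h.mul_eq_univ g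
  rw [← mul_assoc, h.mul_mem_outerProduct_iff (A.mul_mem ha ha') hb,
    h.mul_mem_outerProduct_iff ha' hb]

theorem mul_right_mem_outerProduct_iff (h : DihedralFactorization A B X Y v) {g b : G}
    (hb : b ∈ B) : g * b ∈ outerProduct A B X ↔ (g ∈ outerProduct A B X ↔ b ∈ X) := by
  obtain ⟨a, ha, c, hc, rfl⟩ := exists_mul_eq h.mul_eq_univ g
  rw [mul_assoc, h.mul_mem_outerProduct_iff ha (B.mul_mem hc hb),
    h.mul_mem_outerProduct_iff ha hc, mul_mem_iff_of_relIndex_two h.isDihedralType.relIndex hc hb]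
  tauto

theorem eq_of_mul_inv_mem (h : DihedralFactorization A B X Y v) {x y : G} (hx : x ∈ X)
    (hy : y ∈ X) (hxy : x * y⁻¹ ∈ A) : x = y := by
  have hB : x * y⁻¹ ∈ B := h.isDihedralType.le (X.mul_mem hx (X.inv_mem hy))
  exact mul_inv_eq_one.1 ((Subgroup.eq_bot_iff_forall _).1 h.inf_eq_bot _ ⟨hxy, hB⟩)

theorem finite_inf_normalizer (h : DihedralFactorization A B X Y v) :
    ((A ⊓ Subgroup.normalizer (Subgroup.zpowers v : Set G) : Subgroup G) : Set G).Finite := by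
  refine finite_inf_of_mul_mem h.mul_mem ?_
  rw [h.inf_normalizer]
  exact Set.finite_singleton 1

theorem eventually_mem_zpowers_sq (h : DihedralFactorization A B X Y v) :
    ∀ᶠ x : X in cofinite, (x : G) ^ 2 ≠ 1 ∧ v ∈ Subgroup.zpowers ((x : G) ^ 2) := by
  have hX := h.isDihedralType.isQuasicyclic
  have hv := (hX.isOfFinOrder_of_mem h.mem).orderOf_pos
  rw [eventually_cofinite]
  refine ((hX.finite_setOf_pow_eq_one (mul_pos two_pos hv)).preimage
    Subtype.val_injective.injOn).subset fun x hx => ⟨x.2, ?_⟩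
  rw [pow_mul]
  by_cases hx2 : (x : G) ^ 2 = 1
  · rw [hx2, one_pow]
  · have := (hX.mem_zpowers_or_mem_zpowers_of_mem (X.pow_mem x.2 2) h.mem).resolve_right
      fun hvx => hx ⟨hx2, hvx⟩
    exact orderOf_dvd_iff_pow_eq_one.1 (orderOf_dvd_of_mem_zpowers this)

theorem eq_one_of_commute (h : DihedralFactorization A B X Y v) {x k : G}
    (hvx : v ∈ Subgroup.zpowers x) (hk : k ∈ Y) (hxk : Commute x k) : k = 1 := by
  have hv := h.isDihedralType.isQuasicyclic.isOfFinOrder_of_mem h.mem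
  refine (Subgroup.eq_bot_iff_forall _).1 h.inf_normalizer k
    ⟨hk, (mem_normalizer_zpowers_iff hv).2 ?_⟩
  obtain ⟨i, hi⟩ := hvx
  have hkv : Commute k v := hi ▸ hxk.symm.zpow_right i
  rw [hkv.eq, mul_inv_cancel_right]
  exact Subgroup.mem_zpowers v

theorem mem_normalizer_of_conj_mem (h : DihedralFactorization A B X Y v) {x a : G} (hx : x ^ 2 ≠ 1)
    (hvx : v ∈ Subgroup.zpowers x) (ha : a⁻¹ * x * a ∈ B) :
    a ∈ Subgroup.normalizer (Subgroup.zpowers v : Set G) := by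
  have hX := h.isDihedralType.isQuasicyclic
  have conj_zpow' (i : ℤ) : a⁻¹ * x ^ i * a = (a⁻¹ * x * a) ^ i := by
    simpa using (conj_zpow (i := i) (a := a⁻¹) (b := x)).symm
  have haX : a⁻¹ * x * a ∈ X := by
    by_contra haX
    refine hx (conj_eq_one_iff (a := a⁻¹).1 ?_)
    have := h.sq_eq_one _ ha haX
    rwa [← zpow_natCast, ← conj_zpow', zpow_natCast, ← inv_inv a, inv_inv a⁻¹] at this
  have hvX : a⁻¹ * v * a ∈ X := by
    obtain ⟨i, rfl⟩ := hvx
    exact conj_zpow' i ▸ X.zpow_mem haX i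
  rw [← inv_inv a, inv_mem_iff, mem_normalizer_zpowers_iff (hX.isOfFinOrder_of_mem h.mem), inv_inv]
  refine hX.mem_zpowers_of_orderOf_le hvX h.mem (le_of_eq ?_)
  simpa using (MulAut.conj a⁻¹).orderOf_eq v

theorem mul_mem_of_notMem_outerProduct (h : DihedralFactorization A B X Y v) {g : G}
    (hg : g ∉ outerProduct A B X) : g ∈ (A : Set G) * (X : Set G) := by
  obtain ⟨a, ha, b, hb, rfl⟩ := exists_mul_eq h.mul_eq_univ g
  rw [h.mul_mem_outerProduct_iff ha hb, not_not] at hg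
  exact Set.mul_mem_mul ha hg

theorem eq_of_sq_eq_one (h : DihedralFactorization A B X Y v) {x s t : G}
    (hvx : v ∈ Subgroup.zpowers (x ^ 2)) (hs : s ^ 2 = 1) (ht : t ^ 2 = 1) (hxt : x * t⁻¹ ∈ A)
    (hst : s * t⁻¹ ∈ Y) : s = t := by
  have hs' : s⁻¹ = s := inv_eq_of_mul_eq_one_left (by rw [← pow_two, hs])
  have ht' : t⁻¹ = t := inv_eq_of_mul_eq_one_left (by rw [← pow_two, ht])
  set m := s * t⁻¹ with hm
  have htm : t * m * t⁻¹ = m⁻¹ := by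
    rw [hm, mul_inv_rev, inv_inv, ht', hs', mul_assoc, mul_assoc, ← pow_two, ht, mul_one]
  have hxm : x * m * x⁻¹ = x * t⁻¹ * m⁻¹ * (x * t⁻¹)⁻¹ := by rw [← htm]; group
  refine mul_inv_eq_one.1 (h.eq_one_of_commute hvx hst (mul_inv_eq_iff_eq_mul.1 ?_))
  rw [← hm]
  have hsq : x ^ 2 * m * (x ^ 2)⁻¹ = x * (x * m * x⁻¹) * x⁻¹ := by rw [pow_two]; group
  have hinv (hconj : x * m * x⁻¹ = m⁻¹) : x ^ 2 * m * (x ^ 2)⁻¹ = m := by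
    rw [hsq, hconj, ← conj_inv, hconj, inv_inv]
  rcases h.conj_eq_or_eq_inv _ hxt with ha | ha
  · exact hinv (hxm.trans (ha _ (Y.inv_mem hst)))
  · rw [ha _ (Y.inv_mem hst), inv_inv] at hxm
    rw [hsq, hxm, hxm]

theorem exists_conj_mem_of_mul_mem_outerProduct {x e : G} (he : e ∈ A)
    (hxe : x * e ∈ outerProduct A B X) : ∃ t, x * t⁻¹ ∈ A ∧ e⁻¹ * t * e ∈ (B : Set G) \ X := by
  obtain ⟨a, ha, y, hy, hay⟩ := hxe
  refine ⟨e * y * e⁻¹, ?_, by simpa [mul_assoc] using hy⟩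
  have : x * (e * y * e⁻¹)⁻¹ = a * e⁻¹ := by
    rw [eq_mul_inv_of_mul_eq hay.symm]; group
  exact this ▸ A.mul_mem ha (A.inv_mem he)

theorem sq_eq_one_of_conj_mem (h : DihedralFactorization A B X Y v) {t e : G}
    (ht : e⁻¹ * t * e ∈ (B : Set G) \ X) : t ^ 2 = 1 := by
  refine (conj_eq_one_iff (a := e⁻¹)).1 ?_
  rw [← conj_pow, inv_inv]
  exact h.sq_eq_one _ ht.1 ht.2

theorem finite_setOf_common_conj (h : DihedralFactorization A B X Y v) {e f : G}
    (hef : e⁻¹ * f ∉ Subgroup.normalizer (Subgroup.zpowers v : Set G)) :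
    {x : X | ∃ t, (x : G) * t⁻¹ ∈ A ∧ e⁻¹ * t * e ∈ (B : Set G) \ X ∧
      f⁻¹ * t * f ∈ (B : Set G) \ X}.Finite := by
  by_cases! h0 : ∀ t₀, e⁻¹ * t₀ * e ∈ (B : Set G) \ X → f⁻¹ * t₀ * f ∉ (B : Set G) \ X
  · exact Set.finite_empty.subset fun x ⟨t, _, het, hft⟩ => h0 t het hft
  obtain ⟨t₀, het₀, hft₀⟩ := h0
  have hT : {t | e⁻¹ * t * e ∈ (B : Set G) \ X ∧ f⁻¹ * t * f ∈ (B : Set G) \ X}.Finite := by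
    refine ((eventually_cofinite.1 h.eventually_mem_zpowers_sq).image
      fun p : X => e * p * e⁻¹ * t₀).subset ?_
    rintro t ⟨het, hft⟩
    have conj_div (g : G) : g⁻¹ * t * g * (g⁻¹ * t₀ * g)⁻¹ = g⁻¹ * (t * t₀⁻¹) * g := by group
    have hp : e⁻¹ * (t * t₀⁻¹) * e ∈ X := conj_div e ▸ h.isDihedralType.mul_mem het.1 het.2
      (B.inv_mem het₀.1) (mt X.inv_mem_iff.1 het₀.2)
    refine ⟨⟨_, hp⟩, fun ⟨hp2, hvp⟩ => hef ?_, by simp only; group⟩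
    refine h.mem_normalizer_of_conj_mem hp2 (Subgroup.zpowers_le.2
      ((Subgroup.zpowers _).pow_mem (Subgroup.mem_zpowers _) 2) hvp) ?_
    rw [show (e⁻¹ * f)⁻¹ * (e⁻¹ * (t * t₀⁻¹) * e) * (e⁻¹ * f) = f⁻¹ * (t * t₀⁻¹) * f by group,
      ← conj_div f]
    exact B.mul_mem hft.1 (B.inv_mem hft₀.1)
  refine (hT.biUnion fun t _ => Set.Subsingleton.finite (s := {x : X | (x : G) * t⁻¹ ∈ A})
    fun x hx x' hx' => Subtype.ext (h.eq_of_mul_inv_mem x.2 x'.2 ?_)).subset ?_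
  · simpa [mul_assoc] using A.mul_mem hx (A.inv_mem hx')
  · rintro x ⟨t, hxt, het, hft⟩
    exact Set.mem_biUnion ⟨het, hft⟩ hxt

theorem eventually_not_three (h : DihedralFactorization A B X Y v) {e f g : G} (he : e ∈ A)
    (hf : f ∈ A) (hg : g ∈ A)
    (hef : e⁻¹ * f ∉ Subgroup.normalizer (Subgroup.zpowers v : Set G))
    (heg : e⁻¹ * g ∉ Subgroup.normalizer (Subgroup.zpowers v : Set G))
    (hfg : f⁻¹ * g ∉ Subgroup.normalizer (Subgroup.zpowers v : Set G)) :
    ∀ᶠ x : X in cofinite, ¬ (x * e ∈ outerProduct A B X ∧ x * f ∈ outerProduct A B X ∧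
      x * g ∈ outerProduct A B X) := by
  filter_upwards [h.eventually_mem_zpowers_sq, (h.finite_setOf_common_conj hef).compl_mem_cofinite,
    (h.finite_setOf_common_conj heg).compl_mem_cofinite,
    (h.finite_setOf_common_conj hfg).compl_mem_cofinite] with x hx hxef hxeg hxfg ⟨hxe, hxf, hxg⟩
  obtain ⟨r, hrA, hr⟩ := exists_conj_mem_of_mul_mem_outerProduct he hxe
  obtain ⟨s, hsA, hs⟩ := exists_conj_mem_of_mul_mem_outerProduct hf hxf
  obtain ⟨t, htA, ht⟩ := exists_conj_mem_of_mul_mem_outerProduct hg hxg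
  have notMem {c d s t : G} (hxcd : ¬ ∃ t, (x : G) * t⁻¹ ∈ A ∧ c⁻¹ * t * c ∈ (B : Set G) \ X ∧
      d⁻¹ * t * d ∈ (B : Set G) \ X) (hs : c⁻¹ * s * c ∈ (B : Set G) \ X)
      (ht : d⁻¹ * t * d ∈ (B : Set G) \ X) (htA : (x : G) * t⁻¹ ∈ A) : s * t⁻¹ ∉ Y := fun hst =>
    hxcd ⟨t, htA, h.eq_of_sq_eq_one hx.2 (h.sq_eq_one_of_conj_mem hs) (h.sq_eq_one_of_conj_mem ht)
      htA hst ▸ hs, ht⟩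
  have memA {s t : G} (hsA : (x : G) * s⁻¹ ∈ A) (htA : (x : G) * t⁻¹ ∈ A) : s * t⁻¹ ∈ A := by
    simpa [mul_assoc] using A.mul_mem (A.inv_mem hsA) htA
  refine notMem hxeg hr ht htA ?_
  have := h.mul_mem _ (memA hrA hsA) (notMem hxef hr hs hsA) _ (memA hsA htA)
    (notMem hxfg hs ht htA)
  rwa [mul_assoc, inv_mul_cancel_left] at this

theorem eventually_forall_not_three (h : DihedralFactorization A B X Y v) {ι : Type*} [Finite ι]
    {e : ι → G} (he : ∀ i, e i ∈ A)
    (hne : ∀ i j, i ≠ j → (e i)⁻¹ * e j ∉ Subgroup.normalizer (Subgroup.zpowers v : Set G)) :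
    ∀ᶠ x : X in cofinite, ∀ i j k, i ≠ j → i ≠ k → j ≠ k → ¬ (x * e i ∈ outerProduct A B X ∧
      x * e j ∈ outerProduct A B X ∧ x * e k ∈ outerProduct A B X) := by
  simp only [eventually_all]
  exact fun i j k hij hik hjk =>
    h.eventually_not_three (he i) (he j) (he k) (hne i j hij) (hne i k hik) (hne j k hjk)

theorem exists_translates (h : DihedralFactorization A B X Y v) {c : G}
    (hcv : c ∉ Subgroup.normalizer (Subgroup.zpowers v : Set G)) :
    ∃ r : X → G, (∀ w, r w ∈ A) ∧
      (∀ u w : X, u * w * c ∈ outerProduct A B X ↔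
        (u * r w ∈ outerProduct A B X ↔ w * c ∉ outerProduct A B X)) ∧
      ∀ w, {w' | (r w)⁻¹ * r w' ∈ Subgroup.normalizer (Subgroup.zpowers v : Set G)}.Finite := by
  have hfac (w : X) := exists_mul_eq h.mul_eq_univ ((w : G) * c)
  choose r hr s hs hrs using hfac
  refine ⟨r, hr, fun u w => ?_, fun w => ?_⟩
  · rw [mul_assoc, ← hrs, ← mul_assoc, h.mul_right_mem_outerProduct_iff (hs w),
      h.mul_mem_outerProduct_iff (hr w) (hs w), not_not]
  refine (h.finite_inf_normalizer.biUnion (t := fun k => {w' | r w' = r w * k})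
    fun k _ => ?_).subset fun w' hw' => ?_
  · by_cases! h0 : ∀ w₀, r w₀ ≠ r w * k
    · exact Set.finite_empty.subset fun w' hw' => h0 w' hw'
    obtain ⟨w₀, hw₀⟩ := h0
    refine ((eventually_cofinite.1 h.eventually_mem_zpowers_sq).image fun p => w₀ * p).subset ?_
    refine fun w' hw' => ⟨w₀⁻¹ * w', fun ⟨hp, hvp⟩ => hcv ?_, mul_inv_cancel_left _ _⟩
    refine h.mem_normalizer_of_conj_mem hp (Subgroup.zpowers_le.2
      ((Subgroup.zpowers _).pow_mem (Subgroup.mem_zpowers _) 2) hvp) ?_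
    have : c⁻¹ * ((w₀ : G)⁻¹ * w') * c = (s w₀)⁻¹ * s w' := by
      rw [show c⁻¹ * ((w₀ : G)⁻¹ * w') * c = (w₀ * c)⁻¹ * (w' * c) by group, ← hrs, ← hrs,
        hw₀, hw'.out]
      group
    exact this ▸ B.mul_mem (B.inv_mem (hs _)) (hs _)
  · exact Set.mem_biUnion ⟨A.mul_mem (A.inv_mem (hr w)) (hr w'), hw'⟩ (by simp)

end DihedralFactorization

theorem exists_seq_pairwise_not {α : Type*} {W : Set α} (hW : W.Infinite) {R : α → α → Prop}
    (hsymm : ∀ x y, R x y → R y x) (hR : ∀ w, {w' | R w w'}.Finite) :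
    ∃ f : ℕ → α, (∀ n, f n ∈ W) ∧ ∀ m n, m ≠ n → ¬ R (f m) (f n) := by
  obtain ⟨f, hfW, hf⟩ := exists_seq_of_forall_finset_exists (· ∈ W) (fun x y => ¬ R x y)
    fun s _ => by
      obtain ⟨y, hy, hys⟩ := hW.exists_notMem_finite (s.finite_toSet.biUnion fun x _ => hR x)
      exact ⟨y, hy, fun x hx hxy => hys (Set.mem_biUnion hx hxy)⟩
  exact ⟨f, hfW, fun m n hmn hR => hmn.lt_or_gt.elim (hf m n · hR) (hf n m · (hsymm _ _ hR))⟩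

theorem false_of_forall_not_three {R : Fin 5 → Fin 5 → Prop}
    (hrow : ∀ i j₁ j₂ j₃, j₁ ≠ j₂ → j₁ ≠ j₃ → j₂ ≠ j₃ → R i j₁ ∨ R i j₂ ∨ R i j₃)
    (hcol : ∀ j i₁ i₂ i₃, i₁ ≠ i₂ → i₁ ≠ i₃ → i₂ ≠ i₃ → ¬ (R i₁ j ∧ R i₂ j ∧ R i₃ j)) :
    False := by
  classical
  have hrow' (i : Fin 5) : 3 ≤ (Finset.univ.bipartiteAbove R i).card := by
    have hle : (Finset.univ.filter fun j => ¬ R i j).card ≤ 2 := by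
      by_contra! hlt
      obtain ⟨a, ha, b, hb, c, hc, hab, hac, hbc⟩ := Finset.two_lt_card.1 hlt
      have := hrow i a b c hab hac hbc
      simp_all
    have := Finset.card_filter_add_card_filter_not (s := Finset.univ) (R i)
    rw [Finset.card_univ, Fintype.card_fin] at this
    change 3 ≤ (Finset.univ.filter (R i)).card
    omega
  have hcol' (j : Fin 5) : (Finset.univ.bipartiteBelow R j).card ≤ 2 := by
    by_contra! hlt
    obtain ⟨a, ha, b, hb, c, hc, hab, hac, hbc⟩ := Finset.two_lt_card.1 hlt
    have := hcol j a b c hab hac hbc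
    simp_all [Finset.bipartiteBelow]
  have h₁ := Finset.card_nsmul_le_sum Finset.univ _ 3 fun i _ => hrow' i
  have h₂ := Finset.sum_le_card_nsmul Finset.univ _ 2 fun j _ => hcol' j
  rw [Finset.sum_card_bipartiteAbove_eq_sum_card_bipartiteBelow] at h₁
  simp only [Finset.card_univ, Fintype.card_fin, smul_eq_mul] at h₁ h₂
  omega

namespace DihedralFactorization

open Filter

variable {G : Type*} [Group G] {A B X Y : Subgroup G} {v : G}

theorem exists_five_inequivalent {α : Type*} {W : Set α} (hW : W.Infinite) (r : α → G)
    (hr : ∀ w, {w' | (r w)⁻¹ * r w' ∈ Subgroup.normalizer (Subgroup.zpowers v : Set G)}.Finite) :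
    ∃ f : Fin 5 → α, (∀ i, f i ∈ W) ∧ ∀ i j, i ≠ j →
      (r (f i))⁻¹ * r (f j) ∉ Subgroup.normalizer (Subgroup.zpowers v : Set G) := by
  obtain ⟨f, hfW, hf⟩ := exists_seq_pairwise_not hW (R := fun w w' => (r w)⁻¹ * r w' ∈
    Subgroup.normalizer (Subgroup.zpowers v : Set G))
    (fun w w' hw => by simpa using inv_mem hw) hr
  exact ⟨fun i => f i, fun i => hfW i, fun i j hij => hf i j (Fin.val_injective.ne hij)⟩

theorem eventually_mem_or_eventually_notMem (h : DihedralFactorization A B X Y v) {c : G}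
    (hcv : c ∉ Subgroup.normalizer (Subgroup.zpowers v : Set G)) :
    (∀ᶠ w : X in cofinite, w * c ∈ outerProduct A B X) ∨
      ∀ᶠ w : X in cofinite, w * c ∉ outerProduct A B X := by
  obtain ⟨r, hrA, hr, hrf⟩ := h.exists_translates hcv
  by_contra! hcon
  obtain ⟨f, hf, hfne⟩ := exists_five_inequivalent (frequently_cofinite_iff_infinite.1 hcon.1) r hrf
  obtain ⟨g, hg, hgne⟩ := exists_five_inequivalent (frequently_cofinite_iff_infinite.1 hcon.2) r hrf
  have hrF := h.eventually_forall_not_three (fun i => hrA (f i)) hfne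
  have hrG := h.eventually_forall_not_three (fun i => hrA (g i)) hgne
  have shift (w : X) : Tendsto (fun u : X => u * w) cofinite cofinite :=
    (mul_left_injective w).tendsto_cofinite
  have : Infinite X := h.isDihedralType.isQuasicyclic.infinite_coe.to_subtype
  obtain ⟨u, huf, hug⟩ := ((eventually_all.2 fun j => (shift (g j)).eventually hrF).and
    (eventually_all.2 fun i => (shift (f i)).eventually hrG)).exists
  have hR₁ (i j : Fin 5) : ((u * f i : X) : G) * r (g j) ∈ outerProduct A B X ↔
      u * f i * g j * c ∉ outerProduct A B X := by
    have := hr (u * f i) (g j)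
    have hgj : (g j : G) * c ∈ outerProduct A B X := hg j
    push_cast at this ⊢
    tauto
  have hR₂ (i j : Fin 5) : ((u * g j : X) : G) * r (f i) ∈ outerProduct A B X ↔
      u * f i * g j * c ∈ outerProduct A B X := by
    have := hr (u * g j) (f i)
    have hfi : (f i : G) * c ∉ outerProduct A B X := hf i
    rw [mul_assoc (u : G), (h.isDihedralType.isQuasicyclic.commute (f i).2 (g j).2).eq, ← mul_assoc]
    push_cast at this ⊢
    tauto
  refine false_of_forall_not_three (R := fun i j => u * f i * g j * c ∈ outerProduct A B X)
    (fun i j₁ j₂ j₃ h₁₂ h₁₃ h₂₃ => ?_) (fun j i₁ i₂ i₃ h₁₂ h₁₃ h₂₃ => ?_)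
  · have := hug i j₁ j₂ j₃ h₁₂ h₁₃ h₂₃
    simp only [hR₁] at this
    tauto
  · have := huf j i₁ i₂ i₃ h₁₂ h₁₃ h₂₃
    simpa only [hR₂] using this

theorem finite_setOf_not_eventually_notMem (h : DihedralFactorization A B X Y v) :
    {c ∈ A | ¬ ∀ᶠ w : X in cofinite, w * c ∉ outerProduct A B X}.Finite := by
  have : Infinite X := h.isDihedralType.isQuasicyclic.infinite_coe.to_subtype
  have hodd : {c : A | ∀ᶠ w : X in cofinite, w * (c : G) ∈ outerProduct A B X}.Finite := by
    by_contra hinf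
    obtain ⟨f, hf, hfne⟩ := exists_five_inequivalent hinf Subtype.val fun c =>
      Set.Finite.preimage ((mul_right_injective (c : G)⁻¹).comp Subtype.val_injective).injOn
        (h.finite_inf_normalizer) |>.subset fun c' hc' =>
          ⟨A.mul_mem (A.inv_mem c.2) c'.2, hc'⟩
    obtain ⟨u, hu, huf⟩ := ((h.eventually_forall_not_three (fun i => (f i).2) hfne).and
      (eventually_all.2 hf)).exists
    exact hu 0 1 2 (by decide) (by decide) (by decide) ⟨huf 0, huf 1, huf 2⟩
  refine (h.finite_inf_normalizer.union (hodd.image Subtype.val)).subset fun c ⟨hc, hcE⟩ => ?_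
  by_cases hcv : c ∈ Subgroup.normalizer (Subgroup.zpowers v : Set G)
  · exact .inl ⟨hc, hcv⟩
  · exact .inr ⟨⟨c, hc⟩, (h.eventually_mem_or_eventually_notMem hcv).resolve_right hcE, rfl⟩

theorem not_eventually_mem (h : DihedralFactorization A B X Y v) {c : G} (hc : c ∈ A) :
    ¬ ∀ᶠ w : X in cofinite, w * c ∈ outerProduct A B X := by
  intro hodd
  have : Infinite X := h.isDihedralType.isQuasicyclic.infinite_coe.to_subtype
  obtain ⟨e, he, hev⟩ := h.infinite_left.exists_notMem_finite
    ((h.finite_setOf_not_eventually_notMem.preimage (mul_right_injective c).injOn).union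
      h.finite_setOf_not_eventually_notMem.inv)
  have hce : ∀ᶠ w : X in cofinite, w * (c * e) ∉ outerProduct A B X :=
    by_contra fun hcon => hev (.inl ⟨A.mul_mem hc he, hcon⟩)
  have heinv : ∀ᶠ w : X in cofinite, w * e⁻¹ ∉ outerProduct A B X :=
    by_contra fun hcon => hev (.inr ⟨A.inv_mem he, hcon⟩)
  have key : ∀ᶠ w : X in cofinite, w ∈ ⋃ x ∈ {x : X | ¬ x * e⁻¹ ∉ outerProduct A B X},
      {w : X | ∃ a ∈ A, a * x = w * (c * e)} := by
    filter_upwards [hodd, hce] with w hw hwe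
    obtain ⟨a, ha, x, hx, hax⟩ := h.mul_mem_of_notMem_outerProduct hwe
    refine Set.mem_biUnion (x := ⟨x, hx⟩) (not_not.2 ?_) ⟨a, ha, hax⟩
    have hax' : a * x = w * (c * e) := hax
    rw [← h.left_mul_mem_outerProduct_iff ha, ← mul_assoc, hax']
    simpa [mul_assoc] using hw
  refine frequently_cofinite_iff_infinite.1 key.frequently
    ((eventually_cofinite.1 heinv).biUnion fun x _ => Set.Subsingleton.finite ?_)
  rintro w ⟨a, ha, hax⟩ w' ⟨a', ha', hax'⟩
  refine Subtype.ext (h.eq_of_mul_inv_mem w.2 w'.2 ?_)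
  have : w * (w' : G)⁻¹ = a * a'⁻¹ := by
    rw [eq_mul_inv_of_mul_eq hax.symm, eq_mul_inv_of_mul_eq hax'.symm]; group
  exact this ▸ A.mul_mem ha (A.inv_mem ha')

theorem mul_mem_mul (h : DihedralFactorization A B X Y v) {x a : G} (hx : x ∈ X) (ha : a ∈ A) :
    x * a ∈ (A : Set G) * (X : Set G) := by
  have key {c x : G} (hc : c ∈ A) (hcv : c ∉ Subgroup.normalizer (Subgroup.zpowers v : Set G))
      (hx : x ∈ X) : x * c ∈ (A : Set G) * (X : Set G) := by
    refine h.mul_mem_of_notMem_outerProduct fun hxc => ?_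
    obtain ⟨r, hrA, hr, -⟩ := h.exists_translates hcv
    have hev := (h.eventually_mem_or_eventually_notMem hcv).resolve_left
      (h.not_eventually_mem hc)
    refine h.not_eventually_mem (hrA ⟨x, hx⟩) ?_
    filter_upwards [((mul_left_injective (⟨x, hx⟩ : X)).tendsto_cofinite).eventually hev] with u hu
    have := hr u ⟨x, hx⟩
    push_cast at hu
    tauto
  by_cases hav : a ∈ Subgroup.normalizer (Subgroup.zpowers v : Set G)
  · obtain ⟨e, he, hev⟩ := h.infinite_left.exists_notMem_finite h.finite_inf_normalizer
    have hev : e ∉ Subgroup.normalizer (Subgroup.zpowers v : Set G) := fun hev' => hev ⟨he, hev'⟩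
    obtain ⟨a₁, ha₁, x₁, hx₁, h₁⟩ :=
      key (A.mul_mem ha he) (mt (Subgroup.mul_mem_cancel_left _ hav).1 hev) hx
    obtain ⟨a₂, ha₂, x₂, hx₂, h₂⟩ := key (A.inv_mem he) (mt inv_mem_iff.1 hev) hx₁
    refine ⟨a₁ * a₂, A.mul_mem ha₁ ha₂, x₂, hx₂, ?_⟩
    simp only at h₁ h₂ ⊢
    rw [mul_assoc, h₂, ← mul_assoc, h₁, ← mul_assoc, mul_inv_cancel_right]
  · exact key ha hav hx

end DihedralFactorization

namespace IsQuasicyclic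

variable {G : Type*} [Group G] {X : Subgroup G}

theorem commute_conj_of_le_normalCore (hX : IsQuasicyclic X) {v : G} (hv : IsOfFinOrder v)
    (hXv : X ≤ (Subgroup.normalizer (Subgroup.zpowers v : Set G)).normalCore) {x : G}
    (hx : x ∈ X) (g : G) : Commute x (g * v * g⁻¹) := by
  have hgv : IsOfFinOrder (g * v * g⁻¹) :=
    ((MulAut.conj g).toMonoidHom.isOfFinOrder hv :)
  have : Finite (Subgroup.zpowers (g * v * g⁻¹)) := hgv.finite_zpowers
  refine hX.commute_of_le_normalizer (fun x hx => ?_) hx (Subgroup.mem_zpowers _)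
  obtain ⟨k, hk⟩ := (mem_normalizer_zpowers_iff hv).1 (hXv hx g⁻¹)
  refine (mem_normalizer_zpowers_iff hgv).2 ⟨k, ?_⟩
  simp only [conj_zpow] at hk ⊢
  rw [hk]
  group

theorem commute_of_finite_normal (hX : IsQuasicyclic X) {N : Subgroup G} [Finite N] [N.Normal]
    {x n : G} (hx : x ∈ X) (hn : n ∈ N) : Commute x n :=
  hX.commute_of_le_normalizer (N.normalizer_eq_top ▸ le_top) hx hn

end IsQuasicyclic

namespace IsDihedralType

variable {G : Type*} [Group G] {A B X : Subgroup G}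

theorem le_of_mem_normal (h : IsDihedralType B X) {N : Subgroup G} [hN : N.Normal] {y : G}
    (hy : y ∈ B) (hyX : y ∉ X) (hyN : y ∈ N) : B ≤ N := by
  have hXN : X ≤ N := by
    intro x hx
    obtain ⟨u, hu, rfl⟩ := h.isQuasicyclic.exists_pow_eq two_pos hx
    have : u ^ 2 = u * y * u⁻¹ * y⁻¹ := by
      rw [show u * y * u⁻¹ * y⁻¹ = u * (y * u⁻¹ * y⁻¹) by group,
        h.conj_eq_inv y hy hyX _ (X.inv_mem hu), inv_inv, pow_two]
    rw [this]
    exact N.mul_mem (hN.conj_mem y hyN u) (N.inv_mem hyN)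
  intro b hb
  by_cases hbX : b ∈ X
  · exact hXN hbX
  · exact (N.mul_mem_cancel_right hyN).1 (hXN (h.mul_mem hb hbX hy hyX))

theorem inf_le_of_not_le (h : IsDihedralType B X) {N : Subgroup G} [N.Normal] (hBN : ¬ B ≤ N) :
    B ⊓ N ≤ X :=
  fun _ hb => of_not_not fun hbX => hBN (h.le_of_mem_normal hb.1 hbX hb.2)

theorem conj_mem_of_le (h : IsDihedralType B X) {H : Subgroup G} (hH : H ≤ X) {b x : G}
    (hb : b ∈ B) (hx : x ∈ H) : b * x * b⁻¹ ∈ H := by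
  rcases h.conj_eq_or_eq_inv hb with hb | hb
  · exact (hb x (hH hx)).symm ▸ hx
  · exact (hb x (hH hx)).symm ▸ H.inv_mem hx

theorem le_normalizer_zpowers (h : IsDihedralType B X) {v : G} (hv : v ∈ X) :
    B ≤ Subgroup.normalizer (Subgroup.zpowers v : Set G) := fun _ hb =>
  (mem_normalizer_zpowers_iff (h.isQuasicyclic.isOfFinOrder_of_mem hv)).2
    (h.conj_mem_of_le (Subgroup.zpowers_le.2 hv) hb (Subgroup.mem_zpowers v))

theorem normal_of_conj_mem (h : IsDihedralType B X)
    (hAB : (A : Set G) * (B : Set G) = Set.univ) {H : Subgroup G} (hH : H ≤ X)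
    (hA : ∀ a ∈ A, ∀ x ∈ H, a * x * a⁻¹ ∈ H) : H.Normal := by
  refine ⟨fun x hx g => ?_⟩
  obtain ⟨a, ha, b, hb, rfl⟩ := exists_mul_eq hAB g
  rw [show a * b * x * (a * b)⁻¹ = a * (b * x * b⁻¹) * a⁻¹ by group]
  exact hA a ha _ (h.conj_mem_of_le hH hb hx)

theorem normal_of_finite (h : IsDihedralType B X) (hAB : (A : Set G) * (B : Set G) = Set.univ)
    [Finite A] : X.Normal := by
  have : Finite (G ⧸ B) := by
    refine Finite.of_surjective (fun a : A => ((a : G) : G ⧸ B)) fun q => ?_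
    obtain ⟨g, rfl⟩ := QuotientGroup.mk_surjective q
    obtain ⟨a, ha, b, hb, rfl⟩ := exists_mul_eq hAB g
    exact ⟨⟨a, ha⟩, by simpa [QuotientGroup.eq] using hb⟩
  have : B.FiniteIndex := Subgroup.finiteIndex_of_finite_quotient
  have : X.FiniteIndex := ⟨by
    rw [← Subgroup.relIndex_mul_index h.le, h.relIndex]
    exact mul_ne_zero two_ne_zero Subgroup.FiniteIndex.index_ne_zero⟩
  rw [← h.isQuasicyclic.eq_of_infinite X.normalCore_le fun hfin => ?_]
  · exact X.normalCore_normal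
  · have : Finite X.normalCore := hfin
    have : Finite G := (Subgroup.finite_iff_finite_and_finiteIndex _).2 ⟨this, inferInstance⟩
    exact h.isQuasicyclic.infinite_coe (Set.toFinite _)

theorem commute_sq (h : IsDihedralType B X) {y : G} (hy : y ∈ B) (hyX : y ∉ X) {b : G}
    (hb : b ∈ B) : Commute b (y ^ 2) := by
  by_cases hbX : b ∈ X
  · exact h.isQuasicyclic.commute hbX (h.sq_mem hy)
  · exact h.sq_eq_sq hb hbX hy hyX ▸ Commute.self_pow b 2

theorem finite_setOf_commute (h : IsDihedralType B X) {y : G} (hy : y ∈ B) (hyX : y ∉ X) :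
    {b ∈ B | Commute b y}.Finite := by
  have sq_eq_one {x : G} (hx : x ∈ X) (hxy : Commute x y) : x ^ 2 = 1 := by
    rw [pow_two]
    refine mul_eq_one_iff_eq_inv.2 ?_
    rw [← h.conj_eq_inv y hy hyX x hx, ← hxy.eq, mul_inv_cancel_right]
  have hfin := h.isQuasicyclic.finite_setOf_pow_eq_one two_pos
  refine (hfin.union (hfin.preimage (mul_left_injective y).injOn)).subset ?_
  rintro b ⟨hb, hby⟩
  by_cases hbX : b ∈ X
  · exact .inl ⟨hbX, sq_eq_one hbX hby⟩
  · have := h.mul_mem hb hbX hy hyX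
    exact .inr ⟨this, sq_eq_one this (hby.mul_left (Commute.refl y))⟩

end IsDihedralType

/-- A factorization `G = AB` with `A` abelian and `B ≥ X` of dihedral type, reduced by passing to
the quotient by a maximal normal subgroup `N` such that `AN` avoids `B \ X`. -/
structure AbelianCore {G : Type*} [Group G] (A B X : Subgroup G) : Prop where
  mul_eq_univ : (A : Set G) * (B : Set G) = Set.univ
  commute : ∀ a ∈ A, ∀ c ∈ A, Commute a c
  isDihedralType : IsDihedralType B X
  inf_le : A ⊓ B ≤ X
  exists_mul_mem : ∀ M : Subgroup G, M.Normal → M ≠ ⊥ → ∃ c ∈ A, ∃ m ∈ M, c * m ∈ B ∧ c * m ∉ X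

namespace AbelianCore

variable {G : Type*} [Group G] {A B X : Subgroup G}

theorem eq_bot_of_le (h : AbelianCore A B X) {M : Subgroup G} (hM : M.Normal) (hMX : M ≤ X) :
    M = ⊥ := by
  by_contra hne
  obtain ⟨c, hc, m, hm, hB, hX⟩ := h.exists_mul_mem M hM hne
  have hcB : c ∈ B := (B.mul_mem_cancel_right (h.isDihedralType.le (hMX hm))).1 hB
  exact hX (X.mul_mem (h.inf_le ⟨hc, hcB⟩) (hMX hm))

theorem inf_eq_bot (h : AbelianCore A B X) : A ⊓ B = ⊥ := by
  refine h.eq_bot_of_le (h.isDihedralType.normal_of_conj_mem h.mul_eq_univ h.inf_le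
    fun a ha x hx => ?_) h.inf_le
  rwa [h.commute a ha x hx.1, mul_inv_cancel_right]

theorem infinite (h : AbelianCore A B X) : (A : Set G).Infinite := by
  intro hfin
  have : Finite A := hfin
  have hX := h.isDihedralType.isQuasicyclic.infinite_coe
  rw [h.eq_bot_of_le (h.isDihedralType.normal_of_finite h.mul_eq_univ) le_rfl] at hX
  exact hX (Set.finite_singleton 1)

theorem le_normalCore (h : AbelianCore A B X) {K : Subgroup G} (hBK : B ≤ K) {a : G} (ha : a ∈ A)
    (haK : a ∈ K) (ha1 : a ≠ 1) : B ≤ K.normalCore := by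
  have mem_core {c : G} (hc : c ∈ A) (hcK : c ∈ K) : c ∈ K.normalCore :=
    mem_normalCore_of_forall_conj_mem h.mul_eq_univ hBK fun a ha => by
      rwa [h.commute a ha c hc, mul_inv_cancel_right]
  obtain ⟨c, hc, m, hm, hB, hX⟩ := h.exists_mul_mem K.normalCore inferInstance fun hbot =>
    ha1 (Subgroup.mem_bot.1 (hbot ▸ mem_core ha haK))
  have hcK : c ∈ K := (K.mul_mem_cancel_right (K.normalCore_le hm)).1 (hBK hB)
  exact h.isDihedralType.le_of_mem_normal hB hX (mul_mem (mem_core hc hcK) hm)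

theorem conj_eq_inv_of_mul_mem (h : AbelianCore A B X) {v : G} (hv : v ∈ X)
    [IsMulCommutative (Subgroup.normalClosure {v})] {c m : G} (hc : c ∈ A)
    (hm : m ∈ Subgroup.normalClosure {v}) (hB : c * m ∈ B) (hX : c * m ∉ X) {k : G}
    (hk : k ∈ Subgroup.normalClosure {v}) : (c * m) * k * (c * m)⁻¹ = k⁻¹ := by
  induction hk using normalClosure_singleton_induction with
  | conj g =>
    obtain ⟨a, ha, b, hb, rfl⟩ := exists_mul_eq h.mul_eq_univ g
    have hbv : b * v * b⁻¹ ∈ X := h.isDihedralType.conj_mem hb hv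
    have hbvK := conj_mem_normalClosure_singleton v b
    set w := b * v * b⁻¹
    set n := m⁻¹ * (a⁻¹ * m * a)
    have hn : n ∈ Subgroup.normalClosure {v} :=
      mul_mem (inv_mem hm) (Subgroup.normalClosure_normal.conj_mem' m hm a)
    have hnw : n * w * n⁻¹ = w := mul_inv_eq_of_eq_mul (setLike_mul_comm hn hbvK)
    have ha' : a⁻¹ * (c * m) * a = c * m * n := by
      rw [show a⁻¹ * (c * m) * a = a⁻¹ * c * a * (a⁻¹ * m * a) by group, mul_assoc a⁻¹,
        h.commute c hc a ha, inv_mul_cancel_left]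
      simp only [n]
      group
    have hgv : a * b * v * (a * b)⁻¹ = a * w * a⁻¹ := by simp only [w]; group
    calc c * m * (a * b * v * (a * b)⁻¹) * (c * m)⁻¹
        = a * ((a⁻¹ * (c * m) * a) * w * (a⁻¹ * (c * m) * a)⁻¹) * a⁻¹ := by rw [hgv]; group
      _ = a * ((c * m) * (n * w * n⁻¹) * (c * m)⁻¹) * a⁻¹ := by rw [ha']; group
      _ = a * w⁻¹ * a⁻¹ := by rw [hnw, h.isDihedralType.conj_eq_inv _ hB hX w hbv]
      _ = (a * b * v * (a * b)⁻¹)⁻¹ := by rw [hgv]; group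
  | one => simp
  | mul k l hk hl hki hli =>
    rw [← conj_mul, hki, hli, ← mul_inv_rev, setLike_mul_comm hl hk]
  | inv k _ hki => rw [← conj_inv, hki]

theorem sq_eq_one_of_isMulCommutative (h : AbelianCore A B X) {v : G} (hv : v ∈ X)
    [IsMulCommutative (Subgroup.normalClosure {v})] : v ^ 2 = 1 := by
  by_contra hv2
  have hne : Subgroup.normalClosure {v ^ 2} ≠ ⊥ := fun hbot =>
    hv2 (Subgroup.mem_bot.1 (hbot ▸ Subgroup.subset_normalClosure rfl))
  obtain ⟨c, hc, m, hm, hB, hX⟩ := h.exists_mul_mem _ Subgroup.normalClosure_normal hne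
  obtain ⟨k, hk, rfl⟩ := exists_pow_eq_of_mem_normalClosure hm
  have hinv := h.conj_eq_inv_of_mul_mem hv hc (pow_mem hk 2) hB hX (inv_mem hk)
  set y := c * k ^ 2
  have hky : k * y * k⁻¹ = c := by
    rw [inv_inv, mul_inv_eq_iff_eq_mul] at hinv
    rw [← hinv, mul_assoc, mul_assoc, ← mul_inv_rev, ← pow_two, mul_inv_cancel, mul_one]
  obtain ⟨a, ha, b, hb, rfl⟩ := exists_mul_eq h.mul_eq_univ k
  have hbc : b * y * b⁻¹ = c := by
    calc b * y * b⁻¹ = a⁻¹ * (a * b * y * (a * b)⁻¹) * a := by group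
      _ = c := by rw [hky, mul_assoc, h.commute c hc a ha, inv_mul_cancel_left]
  have hc1 : c = 1 := (Subgroup.eq_bot_iff_forall _).1 h.inf_eq_bot c
    ⟨hc, hbc ▸ B.mul_mem (B.mul_mem hb hB) (B.inv_mem hb)⟩
  exact hX ((conj_eq_one_iff.1 (hbc.trans hc1)).symm ▸ one_mem X)

theorem inf_normalizer_eq_bot (h : AbelianCore A B X) {v : G} (hv : v ∈ X) (hv2 : v ^ 2 ≠ 1) :
    A ⊓ Subgroup.normalizer (Subgroup.zpowers v : Set G) = ⊥ := by
  refine (Subgroup.eq_bot_iff_forall _).2 fun a ⟨ha, hav⟩ => of_not_not fun ha1 => hv2 ?_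
  have hBL := h.le_normalCore (h.isDihedralType.le_normalizer_zpowers hv) ha hav ha1
  have := isMulCommutative_normalClosure_singleton
    (h.isDihedralType.isQuasicyclic.commute_conj_of_le_normalCore
      (h.isDihedralType.isQuasicyclic.isOfFinOrder_of_mem hv) (h.isDihedralType.le.trans hBL) hv)
  exact h.sq_eq_one_of_isMulCommutative hv

theorem exists_mem_sq_ne_one (h : AbelianCore A B X) : ∃ v ∈ X, v ^ 2 ≠ 1 := by
  by_contra! hX
  exact h.isDihedralType.isQuasicyclic.infinite_coe
    ((h.isDihedralType.isQuasicyclic.finite_setOf_pow_eq_one two_pos).subset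
      fun x hx => ⟨hx, hX x hx⟩)

theorem mul_mem_mul_of_sq_eq_one (h : AbelianCore A B X) (hsq : ∀ y ∈ B, y ∉ X → y ^ 2 = 1)
    {x a : G} (hx : x ∈ X) (ha : a ∈ A) : x * a ∈ (A : Set G) * (X : Set G) := by
  obtain ⟨v, hv, hv2⟩ := h.exists_mem_sq_ne_one
  have : DihedralFactorization A B X A v :=
    { mul_eq_univ := h.mul_eq_univ
      inf_eq_bot := h.inf_eq_bot
      infinite_left := h.infinite
      isDihedralType := h.isDihedralType
      sq_eq_one := hsq
      mul_mem := fun a ha hna => absurd ha hna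
      conj_eq_or_eq_inv := fun a ha =>
        .inl fun k hk => mul_inv_eq_of_eq_mul (h.commute a ha k hk)
      mem := hv
      inf_normalizer := h.inf_normalizer_eq_bot hv hv2 }
  exact this.mul_mem_mul hx ha

end AbelianCore

section Commutator

variable {G : Type*} [Group G]

/-- Itô's identity: conjugation by `c * w` and by `w * c` agree on the commutator `⁅a, x⁆`. -/
theorem commute_commutatorElement {A X : Subgroup G} [IsMulCommutative A] [IsMulCommutative X]
    {a c x w : G} (ha : a ∈ A) (hc : c ∈ A) (hx : x ∈ X) (hw : w ∈ X)
    (hcx : c * x ∈ (X : Set G) * (A : Set G)) (hwa : w * a ∈ (A : Set G) * (X : Set G)) :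
    Commute ⁅a, x⁆ ⁅c⁻¹, w⁻¹⁆ := by
  obtain ⟨x', hx', c', hc', hcx : x' * c' = c * x⟩ := hcx
  obtain ⟨a', ha', w', hw', hwa : a' * w' = w * a⟩ := hwa
  have conj_left {a : G} (ha : a ∈ A) : c * ⁅a, x⁆ * c⁻¹ = ⁅a, x'⁆ := by
    calc c * ⁅a, x⁆ * c⁻¹ = (c * a) * x * a⁻¹ * (c * x)⁻¹ := by
          rw [commutatorElement_def]; group
      _ = a * (c * x) * a⁻¹ * (c * x)⁻¹ := by rw [setLike_mul_comm hc ha]; group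
      _ = a * x' * (c' * a⁻¹) * (x' * c')⁻¹ := by rw [← hcx]; group
      _ = ⁅a, x'⁆ := by
          rw [setLike_mul_comm hc' (A.inv_mem ha), commutatorElement_def]; group
  have conj_right {x : G} (hx : x ∈ X) : w * ⁅a, x⁆ * w⁻¹ = ⁅a', x⁆ := by
    calc w * ⁅a, x⁆ * w⁻¹ = (w * a) * x * a⁻¹ * (w * x)⁻¹ := by
          rw [commutatorElement_def]; group
      _ = (w * a) * x * (w * a)⁻¹ * x⁻¹ := by rw [setLike_mul_comm hw hx]; group
      _ = a' * (w' * x) * (a' * w')⁻¹ * x⁻¹ := by rw [← hwa]; group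
      _ = ⁅a', x⁆ := by rw [setLike_mul_comm hw' hx, commutatorElement_def]; group
  have hconj : (c * w) * ⁅a, x⁆ * (c * w)⁻¹ = (w * c) * ⁅a, x⁆ * (w * c)⁻¹ := by
    calc (c * w) * ⁅a, x⁆ * (c * w)⁻¹ = c * (w * ⁅a, x⁆ * w⁻¹) * c⁻¹ := by group
      _ = w * (c * ⁅a, x⁆ * c⁻¹) * w⁻¹ := by
          rw [conj_right hx, conj_left ha', conj_left ha, conj_right hx']
      _ = (w * c) * ⁅a, x⁆ * (w * c)⁻¹ := by group
  refine (mul_inv_eq_iff_eq_mul.1 ?_).symm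
  calc ⁅c⁻¹, w⁻¹⁆ * ⁅a, x⁆ * ⁅c⁻¹, w⁻¹⁆⁻¹
      = (w * c)⁻¹ * ((c * w) * ⁅a, x⁆ * (c * w)⁻¹) * (w * c) := by
        rw [commutatorElement_def c⁻¹]; group
    _ = ⁅a, x⁆ := by rw [hconj]; group

theorem commutatorElement_mem_of_commute {N : Subgroup G} [N.Normal] {a c n m : G}
    (hac : Commute a c) (hn : n ∈ N) (hm : m ∈ N) : ⁅a * n, c * m⁆ ∈ N := by
  have mk_eq_one {n : G} (hn : n ∈ N) : QuotientGroup.mk' N n = 1 :=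
    (QuotientGroup.eq_one_iff n).2 hn
  rw [← QuotientGroup.ker_mk' N, MonoidHom.mem_ker, map_commutatorElement, map_mul, map_mul,
    mk_eq_one hn, mk_eq_one hm, mul_one, mul_one, ← map_commutatorElement,
    commutatorElement_eq_one_iff_commute.2 hac, map_one]

/-- The subgroup generated by all commutators of `z`. -/
def commutatorsOf (z : G) : Subgroup G := Subgroup.closure (Set.range fun g : G => ⁅g, z⁆)

theorem commutatorElement_mem_commutatorsOf (g z : G) : ⁅g, z⁆ ∈ commutatorsOf z :=
  Subgroup.subset_closure ⟨g, rfl⟩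

instance commutatorsOf_normal (z : G) : (commutatorsOf z).Normal := by
  refine ⟨fun n hn g => ?_⟩
  unfold commutatorsOf at hn
  induction hn using Subgroup.closure_induction with
  | mem n hn =>
    obtain ⟨k, rfl⟩ := hn
    have : g * ⁅k, z⁆ * g⁻¹ = ⁅g * k, z⁆ * ⁅g, z⁆⁻¹ := by simp only [commutatorElement_def]; group
    exact this ▸ mul_mem (commutatorElement_mem_commutatorsOf _ z)
      (inv_mem (commutatorElement_mem_commutatorsOf g z))
  | one => simp
  | mul n m _ _ hn hm => exact conj_mul (α := G) ▸ mul_mem hn hm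
  | inv n _ hn => exact conj_inv (a := n) (b := g) ▸ inv_mem hn

theorem conj_eq_inv_of_mem_commutatorsOf {z : G} [IsMulCommutative (commutatorsOf z)]
    (hz : z * z = 1) {n : G} (hn : n ∈ commutatorsOf z) : z * n * z⁻¹ = n⁻¹ := by
  have hinv : z⁻¹ = z := inv_eq_of_mul_eq_one_left hz
  unfold commutatorsOf at hn
  induction hn using Subgroup.closure_induction with
  | mem n hn =>
    obtain ⟨g, rfl⟩ := hn
    calc z * ⁅g, z⁆ * z⁻¹ = z * g * z * g⁻¹ * (z * z)⁻¹ := by rw [commutatorElement_def]; group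
      _ = ⁅g, z⁆⁻¹ := by rw [hz, commutatorElement_inv, commutatorElement_def, hinv]; group
  | one => simp
  | mul n m hn hm ihn ihm =>
    rw [← conj_mul, ihn, ihm, ← mul_inv_rev]
    exact congrArg (·⁻¹) (setLike_mul_comm (s := commutatorsOf z) hm hn)
  | inv n _ ihn => rw [← conj_inv, ihn]

end Commutator

namespace AbelianCore

variable {G : Type*} [Group G] {A B X : Subgroup G} {y : G}

theorem eq_one_of_commute_sq (h : AbelianCore A B X) (hy : y ∈ B) (hyX : y ∉ X)
    (hy2 : y ^ 2 ≠ 1) {a : G} (ha : a ∈ A) (hay : Commute a (y ^ 2)) : a = 1 := by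
  by_contra ha1
  set K := Subgroup.centralizer {y ^ 2}
  set L := K.normalCore
  have hBL : B ≤ L := h.le_normalCore (K := K)
    (fun b hb => Subgroup.mem_centralizer_singleton_iff.2 (h.isDihedralType.commute_sq hy hyX hb))
    ha (Subgroup.mem_centralizer_singleton_iff.2 hay) ha1
  set M := Subgroup.normalClosure {y ^ 2}
  have hML : M ≤ Subgroup.centralizer L := by
    refine Subgroup.normalClosure_le_normal (Set.singleton_subset_iff.2 fun l hl => ?_)
    exact Subgroup.mem_centralizer_singleton_iff.1 (K.normalCore_le hl)
  have : IsMulCommutative M := (Subgroup.le_centralizer_iff_isMulCommutative).1 <|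
    hML.trans <| Subgroup.centralizer_le <| Subgroup.normalClosure_le_normal <|
      Set.singleton_subset_iff.2 (hBL (B.pow_mem hy 2))
  obtain ⟨c, hc, m, hm, hB, hX⟩ := h.exists_mul_mem M Subgroup.normalClosure_normal fun hbot =>
    hy2 (Subgroup.mem_bot.1 (hbot ▸ Subgroup.subset_normalClosure rfl))
  have hm2 : m ^ 2 = 1 := pow_eq_one_of_mem_normalClosure
    (pow_two (y ^ 2) ▸ h.isDihedralType.sq_mul_self hy hyX) hm
  have hc2 : c ^ 2 = y ^ 2 := by
    have hcm : Commute (c * m) m⁻¹ := (show Commute (c * m) m from hML hm _ (hBL hB)).inv_right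
    rw [← h.isDihedralType.sq_eq_sq hB hX hy hyX, ← mul_one ((c * m) ^ 2), ← inv_one, ← hm2,
      ← inv_pow, ← hcm.mul_pow, mul_inv_cancel_right]
  exact hy2 ((Subgroup.eq_bot_iff_forall _).1 h.inf_eq_bot _
    ⟨hc2 ▸ A.pow_mem hc 2, B.pow_mem hy 2⟩)

theorem mem_of_commute_sq (h : AbelianCore A B X) (hy : y ∈ B) (hyX : y ∉ X) (hy2 : y ^ 2 ≠ 1)
    {g : G} (hg : Commute g (y ^ 2)) : g ∈ B := by
  obtain ⟨a, ha, b, hb, rfl⟩ := exists_mul_eq h.mul_eq_univ g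
  have hay : Commute a (y ^ 2) := by
    simpa using hg.mul_left (h.isDihedralType.commute_sq hy hyX hb).inv_left
  rwa [h.eq_one_of_commute_sq hy hyX hy2 ha hay, one_mul]

theorem mul_ne_sq_mul (h : AbelianCore A B X) (hy : y ∈ B) (hyX : y ∉ X) {a c : G} (ha : a ∈ A)
    (hc : c ∈ A) : a * y ≠ y ^ 2 * c := by
  intro he
  have hy4 : y * y ^ 2 = y⁻¹ := eq_inv_of_mul_eq_one_left <| by
    rw [← h.isDihedralType.sq_mul_self hy hyX, mul_assoc, ← pow_succ, ← pow_succ', ← pow_add]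
  have hac : a * (y⁻¹ * c * y⁻¹) = c * y⁻¹ * c := by
    calc a * (y⁻¹ * c * y⁻¹) = (a * y) * (y ^ 2 * c * y⁻¹) := by rw [← hy4]; group
      _ = y ^ 2 * (c * a) := by rw [← he, mul_inv_cancel_right, he, mul_assoc]
      _ = y ^ 2 * (a * y) * y⁻¹ * c := by rw [h.commute c hc a ha]; group
      _ = c * y⁻¹ * c := by rw [he, ← mul_assoc, h.isDihedralType.sq_mul_self hy hyX, one_mul]
  obtain ⟨d, hd, b, hb, hdb⟩ := exists_mul_eq h.mul_eq_univ (y⁻¹ * c)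
  have hby : b * y * b⁻¹ = d⁻¹ * c⁻¹ * a * d := by
    calc b * y * b⁻¹ = d⁻¹ * ((d * b) * y * (d * b)⁻¹) * d := by group
      _ = d⁻¹ * c⁻¹ * (c * y⁻¹ * c) * (y⁻¹ * c * y⁻¹)⁻¹ * d := by rw [hdb]; group
      _ = d⁻¹ * c⁻¹ * a * d := by rw [← hac]; group
  have h1 : b * y * b⁻¹ = 1 := (Subgroup.eq_bot_iff_forall _).1 h.inf_eq_bot _
    ⟨hby ▸ A.mul_mem (A.mul_mem (A.mul_mem (A.inv_mem hd) (A.inv_mem hc)) ha) hd,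
      B.mul_mem (B.mul_mem hb hy) (B.inv_mem hb)⟩
  exact hyX (conj_eq_one_iff.1 h1 ▸ X.one_mem)

theorem sq_mul_mem (h : AbelianCore A B X) (hy : y ∈ B) (hyX : y ∉ X) {c : G} (hc : c ∈ A) :
    y ^ 2 * c ∈ (A : Set G) * (X : Set G) := by
  obtain ⟨a, ha, b, hb, hab⟩ := exists_mul_eq h.mul_eq_univ (y ^ 2 * c)
  have hbX : b ∈ X := of_not_not fun hbX =>
    h.mul_ne_sq_mul hb hbX ha hc (h.isDihedralType.sq_eq_sq hb hbX hy hyX ▸ hab)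
  exact hab ▸ Set.mul_mem_mul ha hbX

theorem isMulCommutative_commutatorsOf (h : AbelianCore A B X) (hy : y ∈ B) (hyX : y ∉ X) :
    IsMulCommutative (commutatorsOf (y ^ 2)) := by
  have exists_eq (g : G) : ∃ a ∈ A, ⁅a, y ^ 2⁆ = ⁅g, y ^ 2⁆ := by
    obtain ⟨a, ha, b, hb, rfl⟩ := exists_mul_eq h.mul_eq_univ g
    refine ⟨a, ha, ?_⟩
    rw [commutatorElement_def, commutatorElement_def, mul_assoc a b,
      h.isDihedralType.commute_sq hy hyX hb]
    group
  refine Subgroup.isMulCommutative_closure ?_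
  rintro _ ⟨g, rfl⟩ _ ⟨k, rfl⟩
  obtain ⟨⟨a, ha, hag⟩, c, hc, hck⟩ := And.intro (exists_eq g) (exists_eq k)
  have : IsMulCommutative A := ⟨⟨fun a c => Subtype.ext (h.commute a a.2 c c.2)⟩⟩
  have := h.isDihedralType.isQuasicyclic.isMulCommutative
  have hzX : y ^ 2 ∈ X := h.isDihedralType.sq_mem hy
  have hz : (y ^ 2)⁻¹ = y ^ 2 :=
    inv_eq_of_mul_eq_one_left (h.isDihedralType.sq_mul_self hy hyX)
  have hcz : c⁻¹ * y ^ 2 ∈ (X : Set G) * (A : Set G) := by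
    obtain ⟨a', ha', x, hx, he : a' * x = y ^ 2 * c⟩ := h.sq_mul_mem hy hyX hc
    refine ⟨x⁻¹, X.inv_mem hx, a'⁻¹, A.inv_mem ha', ?_⟩
    change x⁻¹ * a'⁻¹ = _
    rw [← mul_inv_rev, he, mul_inv_rev, hz]
  have := commute_commutatorElement ha (A.inv_mem hc) hzX hzX hcz (h.sq_mul_mem hy hyX ha)
  rw [inv_inv, hz, hag, hck] at this
  exact this.eq

theorem sq_eq_one_of_commute (h : AbelianCore A B X) (hy : y ∈ B) (hyX : y ∉ X) {n : G}
    (hn : n ∈ commutatorsOf (y ^ 2)) (hny : Commute n (y ^ 2)) : n ^ 2 = 1 := by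
  have := h.isMulCommutative_commutatorsOf hy hyX
  have hinv := conj_eq_inv_of_mem_commutatorsOf (h.isDihedralType.sq_mul_self hy hyX) hn
  rw [pow_two]
  exact mul_eq_one_iff_eq_inv.2 (by rw [← hinv, ← hny.eq, mul_inv_cancel_right])

theorem sq_notMem_commutatorsOf (h : AbelianCore A B X) (hy : y ∈ B) (hyX : y ∉ X)
    (hy2 : y ^ 2 ≠ 1) : y ^ 2 ∉ commutatorsOf (y ^ 2) := by
  intro hyN
  have := h.isMulCommutative_commutatorsOf hy hyX
  obtain ⟨c, hc, m, hm, hB, hX⟩ := h.exists_mul_mem _ (commutatorsOf_normal _) fun hbot =>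
    hy2 (Subgroup.mem_bot.1 (hbot ▸ hyN))
  have hmy : Commute m (y ^ 2) := setLike_mul_comm hm hyN
  have hcy : Commute c (y ^ 2) := by
    simpa using (h.isDihedralType.commute_sq hy hyX hB).mul_left hmy.inv_left
  obtain rfl := h.eq_one_of_commute_sq hy hyX hy2 hc hcy
  rw [one_mul] at hB hX
  exact hy2 (h.isDihedralType.sq_eq_sq hB hX hy hyX ▸ h.sq_eq_one_of_commute hy hyX hm hmy)

theorem eq_one_of_mem_commutatorsOf (h : AbelianCore A B X) (hy : y ∈ B) (hyX : y ∉ X)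
    (hy2 : y ^ 2 ≠ 1) {n : G} (hn : n ∈ commutatorsOf (y ^ 2)) (hny : Commute n (y ^ 2)) :
    n = 1 := by
  by_contra hn1
  have hn2 := h.sq_eq_one_of_commute hy hyX hn hny
  have hnB : n ∈ B := h.mem_of_commute_sq hy hyX hy2 hny
  have hnX : n ∈ X := of_not_not fun hnX =>
    hy2 (h.isDihedralType.sq_eq_sq hnB hnX hy hyX ▸ hn2)
  have hyn : y ^ 2 ∈ Subgroup.zpowers n := by
    refine h.isDihedralType.isQuasicyclic.mem_zpowers_of_orderOf_le
      (h.isDihedralType.sq_mem hy) hnX (le_of_eq ?_)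
    rw [orderOf_eq_prime hn2 hn1,
      orderOf_eq_prime (pow_two (y ^ 2) ▸ h.isDihedralType.sq_mul_self hy hyX) hy2]
  exact h.sq_notMem_commutatorsOf hy hyX hy2 (Subgroup.zpowers_le.2 hn hyn)

theorem commutatorsOf_ne_bot (h : AbelianCore A B X) (hy : y ∈ B) (hyX : y ∉ X)
    (hy2 : y ^ 2 ≠ 1) : commutatorsOf (y ^ 2) ≠ ⊥ := by
  intro hbot
  refine h.infinite ((Set.finite_singleton 1).subset fun a ha => ?_)
  refine h.eq_one_of_commute_sq hy hyX hy2 ha (commutatorElement_eq_one_iff_commute.1 ?_)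
  exact Subgroup.mem_bot.1 (hbot ▸ commutatorElement_mem_commutatorsOf a (y ^ 2))

theorem finite_commutatorsOf (h : AbelianCore A B X) (hy : y ∈ B) (hyX : y ∉ X)
    (hy2 : y ^ 2 ≠ 1) : Finite (commutatorsOf (y ^ 2)) := by
  have := h.isMulCommutative_commutatorsOf hy hyX
  obtain ⟨c, hc, m, hm, hB, hX⟩ :=
    h.exists_mul_mem _ (commutatorsOf_normal _) (h.commutatorsOf_ne_bot hy hyX hy2)
  have eq_one {a : G} (ha : a ∈ A) (haN : a ∈ commutatorsOf (y ^ 2)) : a = 1 := by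
    refine h.eq_one_of_commute_sq hy hyX hy2 ha ?_
    rw [← h.isDihedralType.sq_eq_sq hB hX hy hyX]
    exact (show Commute a (c * m) from
      Commute.mul_right (h.commute a ha c hc) (setLike_mul_comm haN hm)).pow_right 2
  choose! α hα β hβ hαβ using exists_mul_eq h.mul_eq_univ
  have commute_beta {n : G} (hn : n ∈ commutatorsOf (y ^ 2)) : Commute (β n) (c * m) := by
    have hcomm : ⁅β n, c * m⁆ ∈ commutatorsOf (y ^ 2) := by
      rw [show β n = (α n)⁻¹ * n from eq_inv_mul_of_mul_eq (hαβ n)]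
      exact commutatorElement_mem_of_commute (h.commute _ (A.inv_mem (hα n)) c hc) hn hm
    refine commutatorElement_eq_one_iff_commute.1 ?_
    refine h.eq_one_of_mem_commutatorsOf hy hyX hy2 hcomm (h.isDihedralType.commute_sq hy hyX ?_)
    exact B.mul_mem (B.mul_mem (B.mul_mem (hβ n) hB) (B.inv_mem (hβ n))) (B.inv_mem hB)
  have := (h.isDihedralType.finite_setOf_commute hB hX).to_subtype
  refine Finite.of_injective
    (fun n : commutatorsOf (y ^ 2) => (⟨β n, hβ n, commute_beta n.2⟩ : {b ∈ B | Commute b (c * m)}))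
    fun n n' hnn' => Subtype.ext ?_
  have hβn : β n = β n' := congrArg Subtype.val hnn'
  have hdiv : α n * (α n')⁻¹ = n * (n' : G)⁻¹ := by
    calc α n * (α n')⁻¹ = (α n * β n) * (α n' * β n')⁻¹ := by rw [hβn]; group
      _ = n * (n' : G)⁻¹ := by rw [hαβ, hαβ]
  have := eq_one (A.mul_mem (hα n) (A.inv_mem (hα n'))) (hdiv ▸ mul_mem n.2 (inv_mem n'.2))
  exact mul_inv_eq_one.1 (hdiv.symm.trans this)

theorem sq_eq_one (h : AbelianCore A B X) (hy : y ∈ B) (hyX : y ∉ X) : y ^ 2 = 1 := by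
  by_contra hy2
  have := h.finite_commutatorsOf hy hyX hy2
  refine h.commutatorsOf_ne_bot hy hyX hy2 ((Subgroup.eq_bot_iff_forall _).2 fun n hn => ?_)
  refine h.eq_one_of_mem_commutatorsOf hy hyX hy2 hn (Commute.symm ?_)
  refine h.isDihedralType.isQuasicyclic.commute_of_le_normalizer ?_
    (h.isDihedralType.sq_mem hy) hn
  rw [Subgroup.normalizer_eq_top]
  exact le_top

theorem mul_mem_mul (h : AbelianCore A B X) {x a : G} (hx : x ∈ X) (ha : a ∈ A) :
    x * a ∈ (A : Set G) * (X : Set G) :=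
  h.mul_mem_mul_of_sq_eq_one (fun _ hy hyX => h.sq_eq_one hy hyX) hx ha

end AbelianCore

section Quotient

variable {G : Type*} [Group G] {A B X N : Subgroup G}

theorem sup_inf_le_iff [N.Normal] :
    (A ⊔ N) ⊓ B ≤ X ↔ ∀ a ∈ A, ∀ n ∈ N, a * n ∈ B → a * n ∈ X := by
  refine ⟨fun h a ha n hn hB => h ⟨Subgroup.mul_mem_sup ha hn, hB⟩, fun h g ⟨hg, hgB⟩ => ?_⟩
  obtain ⟨a, ha, n, hn, rfl⟩ := Subgroup.mem_sup_of_normal_right.1 hg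
  exact h a ha n hn hgB

theorem exists_maximal_normal (N₀ : Subgroup G) [N₀.Normal] (h : (A ⊔ N₀) ⊓ B ≤ X) :
    ∃ N ≥ N₀, N.Normal ∧ (A ⊔ N) ⊓ B ≤ X ∧
      ∀ M : Subgroup G, M.Normal → N < M → ¬ (A ⊔ M) ⊓ B ≤ X := by
  obtain ⟨N, hN₀, ⟨hN, hNX⟩, hmax⟩ := zorn_le_nonempty₀
    {N : Subgroup G | N.Normal ∧ (A ⊔ N) ⊓ B ≤ X} (fun c hc hchain M hM => by
      have mem_sSup {g : G} : g ∈ sSup c ↔ ∃ N ∈ c, g ∈ N :=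
        Subgroup.mem_sSup_of_directedOn ⟨M, hM⟩ hchain.directedOn
      have hnormal : (sSup c).Normal := ⟨fun n hn g => by
        obtain ⟨N, hNc, hnN⟩ := mem_sSup.1 hn
        exact mem_sSup.2 ⟨N, hNc, (hc hNc).1.conj_mem n hnN g⟩⟩
      refine ⟨sSup c, ⟨hnormal, sup_inf_le_iff.2 fun a ha n hn hB => ?_⟩, fun N hN => le_sSup hN⟩
      obtain ⟨N, hNc, hnN⟩ := mem_sSup.1 hn
      exact (hc hNc).2 ⟨Subgroup.mul_mem_sup ha hnN, hB⟩) N₀ ⟨‹_›, h⟩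
  exact ⟨N, hN₀, hN, hNX, fun M hM hlt hMX => hlt.not_ge (hmax ⟨hM, hMX⟩ hlt.le)⟩

theorem mul_subset_mul_of_le_normal (hAB : (A : Set G) * (B : Set G) = Set.univ)
    (hNX : (A ⊔ N) ⊓ B ≤ X) (hXN : X ≤ N) : (X : Set G) * (A : Set G) ⊆ A * X := by
  rintro _ ⟨x, hx, a, ha, rfl⟩
  obtain ⟨c, hc, b, hb, hcb⟩ := exists_mul_eq hAB (x * a)
  have hbN : b = c⁻¹ * x * a := by rw [mul_assoc, ← hcb, inv_mul_cancel_left]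
  refine ⟨c, hc, b, hNX ⟨hbN ▸ ?_, hb⟩, hcb⟩
  exact (A ⊔ N).mul_mem ((A ⊔ N).mul_mem ((A ⊔ N).inv_mem (Subgroup.mem_sup_left hc))
    (Subgroup.mem_sup_right (hXN hx))) (Subgroup.mem_sup_left ha)

theorem mul_subset_mul_of_map [hN : N.Normal] (hAB : (A : Set G) * (B : Set G) = Set.univ)
    (hXB : X ≤ B) (hNX : (A ⊔ N) ⊓ B ≤ X)
    (h : (X.map (QuotientGroup.mk' N) : Set (G ⧸ N)) * (A.map (QuotientGroup.mk' N) : Set (G ⧸ N))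
      ⊆ A.map (QuotientGroup.mk' N) * X.map (QuotientGroup.mk' N)) :
    (X : Set G) * (A : Set G) ⊆ A * X := by
  rintro _ ⟨x, hx, a, ha, rfl⟩
  obtain ⟨_, ⟨a', ha', rfl⟩, _, ⟨x', hx', rfl⟩, he⟩ := h (Set.mul_mem_mul ⟨x, hx, rfl⟩ ⟨a, ha, rfl⟩)
  obtain ⟨c, hc, b, hb, hcb⟩ := exists_mul_eq hAB (x * a)
  have hn : (a' * x')⁻¹ * (c * b) ∈ N := QuotientGroup.eq.1 (he.trans (congrArg _ hcb.symm))
  have hbx : b * x'⁻¹ = (c⁻¹ * a') * (x' * ((a' * x')⁻¹ * (c * b)) * x'⁻¹) := by group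
  have hbX : b * x'⁻¹ ∈ X := by
    refine hNX ⟨?_, B.mul_mem hb (B.inv_mem (hXB hx'))⟩
    exact hbx ▸ Subgroup.mul_mem_sup (A.mul_mem (A.inv_mem hc) ha') (hN.conj_mem _ hn x')
  exact ⟨c, hc, b, (X.mul_mem_cancel_right (X.inv_mem hx')).1 hbX, hcb⟩

theorem mul_eq_univ_map {H : Type*} [Group H] {f : G →* H} (hf : Function.Surjective f)
    (hAB : (A : Set G) * (B : Set G) = Set.univ) :
    (A.map f : Set H) * (B.map f : Set H) = Set.univ := by
  rw [Subgroup.coe_map, Subgroup.coe_map, ← Set.image_mul, hAB, Set.image_univ, hf.range_eq]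

theorem map_inf_map_le [N.Normal] (hNX : (A ⊔ N) ⊓ B ≤ X) :
    A.map (QuotientGroup.mk' N) ⊓ B.map (QuotientGroup.mk' N) ≤ X.map (QuotientGroup.mk' N) := by
  rintro _ ⟨⟨a, ha, rfl⟩, b, hb, hba⟩
  have hn : a⁻¹ * b ∈ N := QuotientGroup.eq.1 hba.symm
  refine ⟨b, hNX ⟨?_, hb⟩, hba⟩
  simpa using Subgroup.mul_mem_sup ha hn

theorem exists_mul_mem_map [N.Normal] (hXB : X ≤ B) (hNX : B ⊓ N ≤ X)
    (hmax : ∀ M : Subgroup G, M.Normal → N < M → ¬ (A ⊔ M) ⊓ B ≤ X)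
    {M : Subgroup (G ⧸ N)} (hM : M.Normal) (hM1 : M ≠ ⊥) :
    ∃ c ∈ A.map (QuotientGroup.mk' N), ∃ m ∈ M,
      c * m ∈ B.map (QuotientGroup.mk' N) ∧ c * m ∉ X.map (QuotientGroup.mk' N) := by
  set f := QuotientGroup.mk' N
  have hker : f.ker = N := QuotientGroup.ker_mk' N
  have hlt : N < M.comap f := by
    refine lt_of_le_of_ne (hker.ge.trans (Subgroup.ker_le_comap f M)) fun he => hM1 ?_
    rw [← Subgroup.map_comap_eq_self_of_surjective (QuotientGroup.mk'_surjective N) M,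
      Subgroup.map_eq_bot_iff, hker]
    exact he.ge
  have := hmax _ (hM.comap f) hlt
  have hn : (M.comap f).Normal := hM.comap f
  rw [sup_inf_le_iff] at this
  push Not at this
  obtain ⟨a, ha, n, hn, hB, hX⟩ := this
  refine ⟨f a, ⟨a, ha, rfl⟩, f n, hn, ?_⟩
  rw [← map_mul, apply_mem_map_iff hXB (hker.symm ▸ hNX) hB]
  exact ⟨⟨_, hB, rfl⟩, hX⟩

theorem mul_subset_mul_of_isMulCommutative [IsMulCommutative A]
    (hAB : (A : Set G) * (B : Set G) = Set.univ) (hB : IsDihedralType B X) (hX : A ⊓ B ≤ X) :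
    (X : Set G) * (A : Set G) ⊆ A * X := by
  obtain ⟨N, -, hN, hNX, hmax⟩ := exists_maximal_normal ⊥ (sup_bot_eq A ▸ hX)
  by_cases hXN : X ≤ N
  · exact mul_subset_mul_of_le_normal hAB hNX hXN
  have hker := QuotientGroup.ker_mk' N
  have hBN : B ⊓ N ≤ X := fun b hb => hNX ⟨Subgroup.mem_sup_right hb.2, hb.1⟩
  refine mul_subset_mul_of_map hAB hB.le hNX ?_
  rintro _ ⟨x, hx, a, ha, rfl⟩
  refine AbelianCore.mul_mem_mul (B := B.map (QuotientGroup.mk' N)) ?_ hx ha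
  exact
    { mul_eq_univ := mul_eq_univ_map (QuotientGroup.mk'_surjective N) hAB
      commute := fun a ha c hc => setLike_mul_comm ha hc
      isDihedralType := hB.map (hker.symm ▸ hXN) (hker.symm ▸ hBN)
      inf_le := map_inf_map_le hNX
      exists_mul_mem := fun M => exists_mul_mem_map hB.le hBN hmax }

end Quotient

section Swap

variable {G : Type*} [Group G] {A B X Y H : Subgroup G}

theorem le_left_of_mul_eq (hAB : (A : Set G) * (B : Set G) = H) : A ≤ H :=
  fun a ha => hAB.le ⟨a, ha, 1, B.one_mem, mul_one a⟩

theorem le_right_of_mul_eq (hAB : (A : Set G) * (B : Set G) = H) : B ≤ H :=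
  fun b hb => hAB.le ⟨1, A.one_mem, b, hb, one_mul b⟩

theorem subgroupOf_mul_subgroupOf_eq_univ (hAB : (A : Set G) * (B : Set G) = H) :
    (A.subgroupOf H : Set H) * (B.subgroupOf H : Set H) = Set.univ := by
  refine Set.eq_univ_of_forall fun g => ?_
  obtain ⟨a, ha, b, hb, hab⟩ := Set.mem_mul.1 (hAB.ge g.2)
  exact ⟨⟨a, le_left_of_mul_eq hAB ha⟩, ha, ⟨b, le_right_of_mul_eq hAB hb⟩, hb, Subtype.ext hab⟩

theorem mul_subset_mul_of_isMulCommutative_of_mul_eq [IsMulCommutative A]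
    (hAB : (A : Set G) * (B : Set G) = H) (hB : IsDihedralType B X) (hX : A ⊓ B ≤ X) :
    (X : Set G) * (A : Set G) ⊆ A * X := by
  have hAH := le_left_of_mul_eq hAB
  have hBH := le_right_of_mul_eq hAB
  rintro _ ⟨x, hx, a, ha, rfl⟩
  obtain ⟨a', ha', x', hx', he⟩ := mul_subset_mul_of_isMulCommutative
    (subgroupOf_mul_subgroupOf_eq_univ hAB) (hB.subgroupOf hBH) (fun g hg => hX hg)
    (Set.mul_mem_mul (a := ⟨x, hBH (hB.le hx)⟩) hx (b := ⟨a, hAH ha⟩) ha)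
  exact ⟨a', ha', x', hx', congrArg Subtype.val he⟩

theorem coe_sup_eq_mul (h : (X : Set G) * (A : Set G) ⊆ A * X) :
    ((A ⊔ X : Subgroup G) : Set G) = A * X := by
  refine Set.Subset.antisymm (fun g hg => ?_) (Set.mul_subset_iff.2 fun a ha x hx =>
    Subgroup.mul_mem_sup ha hx)
  rw [SetLike.mem_coe, Subgroup.sup_eq_closure_mul] at hg
  induction hg using Subgroup.closure_induction with
  | mem _ hg => exact hg
  | one => exact ⟨1, A.one_mem, 1, X.one_mem, mul_one 1⟩
  | mul g k _ _ hg hk =>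
    obtain ⟨a, ha, x, hx, rfl⟩ := hg
    obtain ⟨c, hc, z, hz, rfl⟩ := hk
    obtain ⟨d, hd, w, hw, he : d * w = x * c⟩ := h ⟨x, hx, c, hc, rfl⟩
    refine ⟨a * d, A.mul_mem ha hd, w * z, X.mul_mem hw hz, ?_⟩
    change a * d * (w * z) = a * x * (c * z)
    rw [mul_assoc a x, ← mul_assoc x, ← he]
    group
  | inv g _ hg =>
    obtain ⟨a, ha, x, hx, rfl⟩ := hg
    exact h ⟨x⁻¹, X.inv_mem hx, a⁻¹, A.inv_mem ha, (mul_inv_rev a x).symm⟩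

theorem mul_comm_of_subset (h : (X : Set G) * (A : Set G) ⊆ A * X) :
    (X : Set G) * (A : Set G) = A * X := by
  rw [← coe_sup_eq_mul h, ← inv_coe_set (H := A ⊔ X), coe_sup_eq_mul h, mul_inv_rev, inv_coe_set,
    inv_coe_set]

/-- When `A ∩ B` is not contained in `Y`, the group is the product of `Y` and `B`. -/
theorem mul_subset_mul_of_mem_inf (hAB : (A : Set G) * (B : Set G) = Set.univ)
    (hA : IsDihedralType A Y) (hB : IsDihedralType B X) (hX : A ⊓ B ≤ X) {b : G}
    (hb : b ∈ A ⊓ B) (hbY : b ∉ Y) : (X : Set G) * (A : Set G) ⊆ A * X := by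
  have mem_or {a : G} (ha : a ∈ A) : a ∈ Y ∨ a * b⁻¹ ∈ Y :=
    or_iff_not_imp_left.2 fun haY =>
      hA.mul_mem ha haY (A.inv_mem hb.1) (mt Y.inv_mem_iff.1 hbY)
  have hYB : (Y : Set G) * (B : Set G) = Set.univ := by
    refine Set.eq_univ_of_forall fun g => ?_
    obtain ⟨a, ha, c, hc, rfl⟩ := exists_mul_eq hAB g
    rcases mem_or ha with ha | ha
    · exact ⟨a, ha, c, hc, rfl⟩
    · exact ⟨a * b⁻¹, ha, b * c, B.mul_mem hb.2 hc, by group⟩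
  have := hA.isQuasicyclic.isMulCommutative
  have hXY := mul_subset_mul_of_isMulCommutative hYB hB
    ((inf_le_inf_right B hA.le).trans hX)
  rintro _ ⟨x, hx, a, ha, rfl⟩
  rcases mem_or ha with ha | ha
  · exact Set.mul_subset_mul_right hA.le (hXY ⟨x, hx, a, ha, rfl⟩)
  · obtain ⟨y, hy, z, hz, hyz : y * z = _⟩ := hXY ⟨x, hx, a * b⁻¹, ha, rfl⟩
    refine ⟨y, hA.le hy, z * b, X.mul_mem hz (hX hb), ?_⟩
    change y * (z * b) = x * a
    rw [← mul_assoc, hyz]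
    group

theorem sq_mem_sup (hB : IsDihedralType B X) (hYX : Y ⊓ B ≤ X)
    (hBY : (Y : Set G) * (B : Set G) = B * Y) (hXY : (X : Set G) * (Y : Set G) ⊆ Y * X) {g : G}
    (hg : g ∈ (Y : Set G) * (B : Set G)) : g ^ 2 ∈ Y ⊔ X := by
  have mem_of_mem {b : G} (hb : b ∈ B) (hbK : b ∈ Y ⊔ X) : b ∈ X := by
    rw [← SetLike.mem_coe, coe_sup_eq_mul hXY] at hbK
    obtain ⟨y, hy, x, hx, rfl⟩ := hbK
    exact X.mul_mem (hYX ⟨hy, (B.mul_mem_cancel_right (hB.le hx)).1 hb⟩) hx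
  obtain ⟨y, hy, b, hb, rfl⟩ := hg
  have hyK : y ∈ Y ⊔ X := Subgroup.mem_sup_left hy
  obtain ⟨z, hz, c, hc, hzc : z * c = b * y⟩ := hBY.ge ⟨b, hb, y, hy, rfl⟩
  have hcb : c * b ∈ X := by
    refine (mul_mem_iff_of_relIndex_two hB.relIndex hc hb).2 ⟨fun hcX => mem_of_mem hb ?_,
      fun hbX => mem_of_mem hc ?_⟩
    · rw [← (Y ⊔ X).mul_mem_cancel_right hyK, ← hzc]
      exact Subgroup.mul_mem_sup hz hcX
    · rw [← (Y ⊔ X).mul_mem_cancel_left (Subgroup.mem_sup_left hz), hzc]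
      exact (Y ⊔ X).mul_mem (Subgroup.mem_sup_right hbX) hyK
  have : (y * b) ^ 2 = y * z * (c * b) := by
    rw [pow_two]
    calc y * b * (y * b) = y * (b * y) * b := by group
      _ = y * z * (c * b) := by rw [← hzc]; group
  change (y * b) ^ 2 ∈ _
  rw [this]
  exact Subgroup.mul_mem_sup (Y.mul_mem hy hz) hcb

theorem inv_conj_mem_sup (hAB : (A : Set G) * (B : Set G) = Set.univ) (hA : IsDihedralType A Y)
    {a g : G} (ha : a ∈ A) (haY : a ∉ Y) (hg : g ∈ B ⊔ Y) : a⁻¹ * g * a ∈ B ⊔ Y := by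
  obtain ⟨c, hc, b, hb, hcb⟩ := exists_mul_eq hAB (a⁻¹ * g * a)
  rw [← hcb]
  refine (B ⊔ Y).mul_mem ?_ (Subgroup.mem_sup_left hb)
  by_cases hcY : c ∈ Y
  · exact Subgroup.mem_sup_right hcY
  have hacY : a * c ∈ Y := hA.mul_mem ha haY hc hcY
  have haH : a ∈ B ⊔ Y := by
    rw [← (B ⊔ Y).mul_mem_cancel_left hg, show g * a = a * c * b by rw [mul_assoc, hcb]; group,
      sup_comm]
    exact Subgroup.mul_mem_sup hacY hb
  exact ((B ⊔ Y).mul_mem_cancel_left haH).1 (Subgroup.mem_sup_right hacY)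

/-- An element `x = u ^ 2` of `X` is conjugated by `a ∈ A` to a square of the subgroup `B ⊔ Y`,
and these squares lie in `Y ⊔ X`. -/
theorem mul_subset_mul_of_mul_subset (hAB : (A : Set G) * (B : Set G) = Set.univ)
    (hA : IsDihedralType A Y) (hB : IsDihedralType B X) (hX : A ⊓ B ≤ X)
    (hYB : (Y : Set G) * (B : Set G) ⊆ B * Y) : (X : Set G) * (A : Set G) ⊆ A * X := by
  have hYX : Y ⊓ B ≤ X := (inf_le_inf_right B hA.le).trans hX
  have hBY := mul_comm_of_subset hYB
  have := hA.isQuasicyclic.isMulCommutative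
  have hXY : (X : Set G) * (Y : Set G) ⊆ Y * X :=
    mul_subset_mul_of_isMulCommutative_of_mul_eq (hBY.trans (coe_sup_eq_mul hYB).symm) hB hYX
  rintro _ ⟨x, hx, a, ha, rfl⟩
  by_cases haY : a ∈ Y
  · exact Set.mul_subset_mul_right hA.le (hXY ⟨x, hx, a, haY, rfl⟩)
  obtain ⟨u, hu, rfl⟩ := hB.isQuasicyclic.exists_pow_eq two_pos hx
  have hmem : (a⁻¹ * u * a) ^ 2 ∈ Y ⊔ X := by
    refine sq_mem_sup hB hYX hBY hXY ?_
    rw [hBY, ← coe_sup_eq_mul hYB]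
    exact inv_conj_mem_sup hAB hA ha haY (Subgroup.mem_sup_left (hB.le hu))
  rw [← SetLike.mem_coe, coe_sup_eq_mul hXY] at hmem
  obtain ⟨y, hy, z, hz, hyz : y * z = _⟩ := hmem
  refine ⟨a * y, A.mul_mem ha (hA.le hy), z, hz, ?_⟩
  change a * y * z = u ^ 2 * a
  rw [mul_assoc, hyz, pow_two, pow_two]
  group

theorem mul_subset_mul_swap (hAB : (A : Set G) * (B : Set G) = Set.univ)
    (hA : IsDihedralType A Y) (hB : IsDihedralType B X)
    (h : B ⊓ A ≤ Y → (Y : Set G) * (B : Set G) ⊆ B * Y) (hX : A ⊓ B ≤ X) :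
    (X : Set G) * (A : Set G) ⊆ A * X := by
  by_cases hY : B ⊓ A ≤ Y
  · exact mul_subset_mul_of_mul_subset hAB hA hB hX (h hY)
  · obtain ⟨b, hb, hbY⟩ := SetLike.not_le_iff_exists.1 hY
    exact mul_subset_mul_of_mem_inf hAB hA hB hX (inf_comm B A ▸ hb) hbY

end Swap

section Involution

variable {G : Type*} [Group G]

theorem isOfFinOrder_of_conj_eq_pow {b r : G} {n : ℕ} (hn : 1 < n) (hb : IsOfFinOrder b)
    (hr : b * r * b⁻¹ = r ^ n) : IsOfFinOrder r := by
  have conj_pow_eq (m : ℕ) : b ^ m * r * (b ^ m)⁻¹ = r ^ n ^ m := by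
    induction m with
    | zero => simp
    | succ m ih =>
      calc b ^ (m + 1) * r * (b ^ (m + 1))⁻¹ = b ^ m * (b * r * b⁻¹) * (b ^ m)⁻¹ := by
            rw [pow_succ]; group
        _ = (b ^ m * r * (b ^ m)⁻¹) ^ n := by rw [hr, conj_pow]
        _ = r ^ n ^ (m + 1) := by rw [ih, ← pow_mul, pow_succ]
  obtain ⟨m, hm, hbm⟩ := isOfFinOrder_iff_pow_eq_one.1 hb
  have hr' : r ^ n ^ m = r := by simpa [hbm] using (conj_pow_eq m).symm
  have hnm : 1 < n ^ m := Nat.one_lt_pow hm.ne' hn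
  refine isOfFinOrder_iff_pow_eq_one.2 ⟨n ^ m - 1, by omega, ?_⟩
  rwa [← mul_eq_right (b := r), ← pow_succ, Nat.sub_add_cancel hnm.le]

variable {i z : G}

theorem conj_mul_pow_of_mul_self (hi : i * i = 1) (hz : z * z = 1) (k : ℕ) :
    i * (i * z) ^ k * i⁻¹ = ((i * z) ^ k)⁻¹ := by
  have hi' : i⁻¹ = i := inv_eq_of_mul_eq_one_left hi
  have hz' : z⁻¹ = z := inv_eq_of_mul_eq_one_left hz
  rw [← conj_pow, ← inv_pow, ← mul_assoc, hi, one_mul, mul_inv_rev, hz', hi']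

theorem exists_commute_or_exists_conj_eq (hi : i * i = 1) (hz : z * z = 1)
    (hr : IsOfFinOrder (i * z)) :
    (∃ g ≠ 1, Commute g i ∧ Commute g z) ∨ ∃ g, g * i * g⁻¹ = z := by
  have hconj := conj_mul_pow_of_mul_self hi hz
  have hzr : z = i⁻¹ * (i * z) := by group
  generalize i * z = r at *
  obtain ⟨k, hk | hk⟩ := Nat.even_or_odd' (orderOf r)
  · have hkk : (r ^ k)⁻¹ = r ^ k := by
      rw [inv_eq_iff_mul_eq_one, ← pow_add, ← two_mul, ← hk, pow_orderOf_eq_one]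
    have hki : Commute (r ^ k) i := (mul_inv_eq_iff_eq_mul.1 ((hconj k).trans hkk)).symm
    refine .inl ⟨r ^ k, fun h1 => ?_, hki, ?_⟩
    · have := hr.orderOf_pos
      have := orderOf_le_of_pow_eq_one (by omega) h1
      omega
    · rw [hzr]
      exact hki.inv_right.mul_right (Commute.pow_self r k)
  · refine .inr ⟨r ^ k, ?_⟩
    have hkr : r ^ k * r ^ k = r⁻¹ := by
      rw [eq_inv_iff_mul_eq_one, ← pow_add, ← two_mul, ← pow_succ, ← hk, pow_orderOf_eq_one]
    calc r ^ k * i * (r ^ k)⁻¹ = r ^ k * (i * r ^ k * i⁻¹)⁻¹ * i := by group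
      _ = r⁻¹ * i := by rw [hconj, inv_inv, hkr]
      _ = z⁻¹ := by rw [hzr]; group
      _ = z := inv_eq_of_mul_eq_one_left hz

variable {A B : Subgroup G}

/-- For `i * z = b * a` one finds `b * (i * z) * b⁻¹ = (i * z) ^ 3`. -/
theorem isOfFinOrder_mul_of_commute (hAB : (A : Set G) * (B : Set G) = Set.univ)
    (hAi : ∀ a ∈ A, Commute a i) (hBz : ∀ b ∈ B, Commute b z) (hi : i * i = 1) (hz : z * z = 1)
    (hB : ∀ b ∈ B, IsOfFinOrder b) : IsOfFinOrder (i * z) := by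
  obtain ⟨b, hb, a, ha, hba⟩ := exists_mul_eq' hAB (i * z)
  refine isOfFinOrder_of_conj_eq_pow (n := 3) (by norm_num) (hB b hb) ?_
  have hbi : b * i * b⁻¹ = (i * z) * i * (i * z)⁻¹ := by
    rw [← hba]
    calc b * i * b⁻¹ = b * (i * a) * a⁻¹ * b⁻¹ := by group
      _ = b * a * i * (b * a)⁻¹ := by rw [← (hAi a ha).eq]; group
  calc b * (i * z) * b⁻¹ = (b * i * b⁻¹) * (b * z * b⁻¹) := by group
    _ = (i * z) * i * (z⁻¹ * i⁻¹) * z := by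
      rw [hbi, (hBz b hb).eq, mul_inv_cancel_right, mul_inv_rev]
    _ = (i * z) ^ 3 := by
      rw [inv_eq_of_mul_eq_one_left hi, inv_eq_of_mul_eq_one_left hz, pow_succ, pow_two]
      simp only [mul_assoc]

theorem eq_one_of_mul_self (hAB : (A : Set G) * (B : Set G) = Set.univ)
    (hAi : ∀ a ∈ A, Commute a i) (hBz : ∀ b ∈ B, Commute b z)
    (hAz : ∀ a ∈ A, Commute a z → a = 1) (hBi : ∀ b ∈ B, Commute b i → b = 1)
    (hi : i * i = 1) (hz : z * z = 1) (hB : ∀ b ∈ B, IsOfFinOrder b) (hiA : i ∈ A) : i = 1 := by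
  rcases exists_commute_or_exists_conj_eq hi hz
    (isOfFinOrder_mul_of_commute hAB hAi hBz hi hz hB) with ⟨g, hg1, hgi, hgz⟩ | ⟨g, hg⟩
  · obtain ⟨a, ha, b, hb, rfl⟩ := exists_mul_eq hAB g
    have ha1 : a = 1 := hAz a ha (by simpa using hgz.mul_left (hBz b hb).inv_left)
    rw [ha1, one_mul] at hg1 hgi
    exact absurd (hBi b hb hgi) hg1
  · obtain ⟨b, hb, a, ha, rfl⟩ := exists_mul_eq' hAB g
    have hiz : i = z := by
      calc i = b⁻¹ * (b * (a * i * a⁻¹) * b⁻¹) * b := by rw [(hAi a ha).eq]; group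
        _ = b⁻¹ * (b * a * i * (b * a)⁻¹) * b := by group
        _ = z := by rw [hg, mul_assoc, ← (hBz b hb).eq, inv_mul_cancel_left]
    exact hAz i hiA (hiz ▸ Commute.refl i)

end Involution

/-- A factorization `G = AB` by two groups `A ≥ Y` and `B ≥ X` of dihedral type, reduced by passing
to the quotient by a maximal normal subgroup `N` such that `AN` avoids `B \ X` or `BN` avoids
`A \ Y`. -/
structure DihedralCore {G : Type*} [Group G] (A B X Y : Subgroup G) : Prop where
  mul_eq_univ : (A : Set G) * (B : Set G) = Set.univ
  isDihedralType_left : IsDihedralType A Y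
  isDihedralType_right : IsDihedralType B X
  inf_eq_bot : A ⊓ B = ⊥
  exists_mul_mem_left : ∀ M : Subgroup G, M.Normal → M ≠ ⊥ →
    ∃ b ∈ B, ∃ m ∈ M, b * m ∈ A ∧ b * m ∉ Y
  exists_mul_mem_right : ∀ M : Subgroup G, M.Normal → M ≠ ⊥ →
    ∃ a ∈ A, ∃ m ∈ M, a * m ∈ B ∧ a * m ∉ X

namespace DihedralCore

variable {G : Type*} [Group G] {A B X Y : Subgroup G}

theorem symm (h : DihedralCore A B X Y) : DihedralCore B A Y X :=
  ⟨mul_eq_univ_symm h.mul_eq_univ, h.isDihedralType_right, h.isDihedralType_left,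
    inf_comm B A ▸ h.inf_eq_bot, h.exists_mul_mem_right, h.exists_mul_mem_left⟩

theorem not_le_normalizer (h : DihedralCore A B X Y) {v : G} (hv : v ∈ X) (hv1 : v ≠ 1) :
    ¬ A ≤ Subgroup.normalizer (Subgroup.zpowers v : Set G) := by
  intro hA
  have hvX : Subgroup.zpowers v ≤ X := Subgroup.zpowers_le.2 hv
  have hn : (Subgroup.zpowers v).Normal :=
    h.isDihedralType_right.normal_of_conj_mem h.mul_eq_univ hvX
      fun a ha x hx => (Subgroup.mem_normalizer_iff.1 (hA ha) x).1 hx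
  obtain ⟨a, ha, m, hm, hB, hX⟩ := h.exists_mul_mem_right _ hn (by simpa using hv1)
  have haB : a ∈ B := (B.mul_mem_cancel_right (h.isDihedralType_right.le (hvX hm))).1 hB
  have ha1 : a = 1 := (Subgroup.eq_bot_iff_forall _).1 h.inf_eq_bot a ⟨ha, haB⟩
  rw [ha1, one_mul] at hX
  exact hX (hvX hm)

theorem not_le_normalizer_of_notMem (h : DihedralCore A B X Y) {v : G} (hv : v ∈ X) (hv1 : v ≠ 1)
    {a : G} (ha : a ∈ A) (haY : a ∉ Y)
    (hav : a ∈ Subgroup.normalizer (Subgroup.zpowers v : Set G)) :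
    ¬ Y ≤ Subgroup.normalizer (Subgroup.zpowers v : Set G) := by
  refine fun hY => h.not_le_normalizer hv hv1 fun c hc => ?_
  by_cases hcY : c ∈ Y
  · exact hY hcY
  · exact ((Subgroup.normalizer (Subgroup.zpowers v : Set G)).mul_mem_cancel_right hav).1
      (hY (h.isDihedralType_left.mul_mem hc hcY ha haY))

theorem finite_inf_left (h : DihedralCore A B X Y) {H : Subgroup G} (hY : ¬ Y ≤ H) :
    ((A ⊓ H : Subgroup G) : Set G).Finite := by
  obtain ⟨y, hy, hyH⟩ := SetLike.not_le_iff_exists.1 hY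
  exact finite_inf_of_mul_mem (fun a ha haY b hb => h.isDihedralType_left.mul_mem ha haY hb)
    (h.isDihedralType_left.isQuasicyclic.finite_of_notMem inf_le_left hy fun hyH' => hyH hyH'.2)

theorem commute_of_isMulCommutative (h : DihedralCore A B X Y) {v : G} (hv : v ∈ X)
    [IsMulCommutative (Subgroup.normalClosure {v})] {y : G} (hy : y ∈ Y) : Commute y v := by
  have hA := h.isDihedralType_left
  have hB := h.isDihedralType_right
  set K := Subgroup.normalClosure {v}
  have hvK : v ∈ K := Subgroup.subset_normalClosure rfl
  by_cases hYK : Y ≤ B ⊔ K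
  · obtain ⟨u, hu, rfl⟩ := hA.isQuasicyclic.exists_pow_eq two_pos hy
    obtain ⟨b, hb, k, hk, rfl⟩ := Subgroup.mem_sup_of_normal_right.1 (hYK hu)
    have hconj : b⁻¹ * k * b ∈ K := Subgroup.normalClosure_normal.conj_mem' k hk b
    rw [show (b * k) ^ 2 = b ^ 2 * (b⁻¹ * k * b * k) by simp only [pow_two]; group]
    exact (hB.isQuasicyclic.commute (hB.sq_mem hb) hv).mul_left
      (setLike_mul_comm (K.mul_mem hconj hk) hvK)
  · have hvf := hB.isQuasicyclic.isOfFinOrder_of_mem hv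
    have hBK : B ⊓ K ≤ X := hB.inf_le_of_not_le fun hBK =>
      hB.not_isMulCommutative
        ⟨⟨fun b c => Subtype.ext (setLike_mul_comm (hBK b.2) (hBK c.2))⟩⟩
    have : Finite K := finite_of_finite_inf h.mul_eq_univ le_sup_right le_sup_left
      (h.finite_inf_left hYK)
      ((hB.isQuasicyclic.finite_setOf_pow_eq_one hvf.orderOf_pos).subset fun b hb =>
        ⟨hBK hb, pow_eq_one_of_mem_normalClosure (pow_orderOf_eq_one v) hb.2⟩)
    exact hA.isQuasicyclic.commute_of_finite_normal hy hvK

theorem not_isMulCommutative_normalClosure (h : DihedralCore A B X Y) {v : G} (hv : v ∈ X)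
    (hv1 : v ≠ 1) : ¬ IsMulCommutative (Subgroup.normalClosure {v}) := by
  intro hK
  have hvK : v ∈ Subgroup.normalClosure {v} := Subgroup.subset_normalClosure rfl
  obtain ⟨b, hb, k, hk, hA, hY⟩ := h.exists_mul_mem_left _ Subgroup.normalClosure_normal
    fun hbot => hv1 (Subgroup.mem_bot.1 (hbot ▸ hvK))
  exact h.not_le_normalizer_of_notMem hv hv1 hA hY
    (Subgroup.mul_mem _ (h.isDihedralType_right.le_normalizer_zpowers hv hb)
      (mem_normalizer_zpowers_of_commute (setLike_mul_comm hk hvK)))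
    fun y hy => mem_normalizer_zpowers_of_commute (h.commute_of_isMulCommutative hv hy)

theorem inf_normalizer_eq_bot (h : DihedralCore A B X Y) {v : G} (hv : v ∈ X) (hv1 : v ≠ 1) :
    Y ⊓ Subgroup.normalizer (Subgroup.zpowers v : Set G) = ⊥ := by
  have hA := h.isDihedralType_left
  have hB := h.isDihedralType_right
  refine (Subgroup.eq_bot_iff_forall _).2 fun s ⟨hs, hsv⟩ => of_not_not fun hs1 => ?_
  have hBv := hB.le_normalizer_zpowers hv
  set L := (Subgroup.normalizer (Subgroup.zpowers v : Set G)).normalCore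
  have hLv : L ≤ Subgroup.normalizer (Subgroup.zpowers v : Set G) := Subgroup.normalCore_le _
  have hsL : s ∈ L := mem_normalCore_of_forall_conj_mem h.mul_eq_univ hBv fun a ha =>
    (Subgroup.zpowers_le.2 hsv) (hA.conj_mem_of_le (Subgroup.zpowers_le.2 hs) ha
      (Subgroup.mem_zpowers s))
  have hXL : ¬ X ≤ L := fun hXL => h.not_isMulCommutative_normalClosure hv hv1
    (isMulCommutative_normalClosure_singleton (hB.isQuasicyclic.commute_conj_of_le_normalCore
      (hB.isQuasicyclic.isOfFinOrder_of_mem hv) hXL hv))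
  obtain ⟨x, hx, hxL⟩ := SetLike.not_le_iff_exists.1 hXL
  have hBL : B ⊓ L ≤ X := hB.inf_le_of_not_le fun hBL => hXL (hB.le.trans hBL)
  have hfin : ((B ⊓ L : Subgroup G) : Set G).Finite :=
    hB.isQuasicyclic.finite_of_notMem hBL hx fun hxL' => hxL hxL'.2
  obtain ⟨b, hb, m, hm, hbmA, hbmY⟩ := h.exists_mul_mem_left L inferInstance
    fun hbot => hs1 (Subgroup.mem_bot.1 (hbot ▸ hsL))
  have : Finite L := finite_of_finite_inf h.mul_eq_univ hLv hBv
    (h.finite_inf_left (h.not_le_normalizer_of_notMem hv hv1 hbmA hbmY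
      (Subgroup.mul_mem _ (hBv hb) (hLv hm)))) hfin
  refine h.symm.not_isMulCommutative_normalClosure hs hs1
    (isMulCommutative_normalClosure_singleton fun g => ?_)
  exact hA.isQuasicyclic.commute_of_finite_normal hs
    (Subgroup.Normal.conj_mem inferInstance s hsL g)

theorem mul_subset_mul_of_sq_eq_one (h : DihedralCore A B X Y)
    (hsq : ∀ y ∈ B, y ∉ X → y ^ 2 = 1) : (X : Set G) * (A : Set G) ⊆ A * X := by
  have hA := h.isDihedralType_left
  have hX := h.isDihedralType_right.isQuasicyclic.infinite_coe
  obtain ⟨v, hv, hv1⟩ := hX.nontrivial.exists_ne 1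
  have : DihedralFactorization A B X Y v :=
    { mul_eq_univ := h.mul_eq_univ
      inf_eq_bot := h.inf_eq_bot
      infinite_left := hA.isQuasicyclic.infinite_coe.mono hA.le
      isDihedralType := h.isDihedralType_right
      sq_eq_one := hsq
      mul_mem := fun a ha haY b hb hbY => hA.mul_mem ha haY hb hbY
      conj_eq_or_eq_inv := fun a ha => hA.conj_eq_or_eq_inv ha
      mem := hv
      inf_normalizer := h.inf_normalizer_eq_bot hv hv1 }
  rintro _ ⟨x, hx, a, ha, rfl⟩
  exact this.mul_mem_mul hx ha

theorem eq_one_of_commute_sq (h : DihedralCore A B X Y) {a b : G} (ha : a ∈ A) (haY : a ∉ Y)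
    (ha2 : a ^ 2 ≠ 1) (hb : b ∈ B) (hb2 : b ^ 2 ≠ 1) {c : G} (hc : c ∈ A)
    (hcb : Commute c (b ^ 2)) : c = 1 := by
  have hA := h.isDihedralType_left
  have hbX := h.isDihedralType_right.sq_mem hb
  have eq_one {y : G} (hy : y ∈ Y) (hyb : Commute y (b ^ 2)) : y = 1 := by
    refine (Subgroup.eq_bot_iff_forall _).1 (h.inf_normalizer_eq_bot hbX hb2) y
      ⟨hy, mem_normalizer_zpowers_of_commute hyb⟩
  by_cases hcY : c ∈ Y
  · exact eq_one hcY hcb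
  · exact absurd (eq_one (hA.sq_mem ha) (hA.sq_eq_sq hc hcY ha haY ▸ hcb.pow_left 2)) ha2

theorem sq_eq_one_or_sq_eq_one (h : DihedralCore A B X Y) {a b : G} (ha : a ∈ A) (haY : a ∉ Y)
    (hb : b ∈ B) (hbX : b ∉ X) : a ^ 2 = 1 ∨ b ^ 2 = 1 := by
  have hA := h.isDihedralType_left
  have hB := h.isDihedralType_right
  by_contra! h2
  refine h2.1 (eq_one_of_mul_self h.mul_eq_univ (z := b ^ 2) (fun c hc => hA.commute_sq ha haY hc)
    (fun c hc => hB.commute_sq hb hbX hc)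
    (fun c hc => h.eq_one_of_commute_sq ha haY h2.1 hb h2.2 hc)
    (fun c hc => h.symm.eq_one_of_commute_sq hb hbX h2.2 ha h2.1 hc)
    (hA.sq_mul_self ha haY) (hB.sq_mul_self hb hbX) (fun c hc => ?_) (hA.le (hA.sq_mem ha)))
  exact (hB.isQuasicyclic.isOfFinOrder_of_mem (hB.sq_mem hc)).of_pow two_ne_zero

theorem mul_subset_mul (h : DihedralCore A B X Y) : (X : Set G) * (A : Set G) ⊆ A * X := by
  have hA := h.isDihedralType_left
  have hB := h.isDihedralType_right
  obtain ⟨a, ha, haY⟩ := hA.exists_notMem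
  obtain ⟨b, hb, hbX⟩ := hB.exists_notMem
  rcases h.sq_eq_one_or_sq_eq_one ha haY hb hbX with ha2 | hb2
  · exact mul_subset_mul_swap h.mul_eq_univ hA hB
      (fun _ => h.symm.mul_subset_mul_of_sq_eq_one fun c hc hcY =>
        (hA.sq_eq_sq hc hcY ha haY).trans ha2) (h.inf_eq_bot.trans_le bot_le)
  · exact h.mul_subset_mul_of_sq_eq_one fun c hc hcX => (hB.sq_eq_sq hc hcX hb hbX).trans hb2

end DihedralCore

section Dihedral

variable {G : Type*} [Group G] {A B X Y N : Subgroup G}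

theorem IsDihedralType.isMulCommutative_map {H : Type*} [Group H] {f : G →* H}
    (h : IsDihedralType B X) (hX : X ≤ f.ker) : IsMulCommutative (B.map f) := by
  refine ⟨⟨?_⟩⟩
  rintro ⟨_, b, hb, rfl⟩ ⟨_, c, hc, rfl⟩
  refine Subtype.ext (?_ : f b * f c = f c * f b)
  by_cases hbX : b ∈ X
  · rw [hX hbX, one_mul, mul_one]
  by_cases hcX : c ∈ X
  · rw [hX hcX, one_mul, mul_one]
  have : f (b * c⁻¹) = 1 := hX (h.mul_mem hb hbX (B.inv_mem hc) (mt X.inv_mem_iff.1 hcX))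
  rw [map_mul, map_inv, mul_inv_eq_one] at this
  rw [this]

theorem DihedralCore.of_inf_le (hAB : (A : Set G) * (B : Set G) = Set.univ)
    (hA : IsDihedralType A Y) (hB : IsDihedralType B X) (hX : A ⊓ B ≤ X) (hY : A ⊓ B ≤ Y)
    (hmulA : ∀ M : Subgroup G, M.Normal → M ≠ ⊥ → ∃ b ∈ B, ∃ m ∈ M, b * m ∈ A ∧ b * m ∉ Y)
    (hmulB : ∀ M : Subgroup G, M.Normal → M ≠ ⊥ → ∃ a ∈ A, ∃ m ∈ M, a * m ∈ B ∧ a * m ∉ X) :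
    DihedralCore A B X Y := by
  refine ⟨hAB, hA, hB, of_not_not fun hbot => ?_, hmulA, hmulB⟩
  obtain ⟨a, ha, m, hm, hmB, hmX⟩ := hmulB (A ⊓ B)
    (hB.normal_of_conj_mem hAB hX fun a ha x hx => hA.conj_mem_of_le hY ha hx) hbot
  exact hmX (hX ⟨A.mul_mem ha hm.1, hmB⟩)

theorem mul_subset_mul_of_maximal [N.Normal] (hAB : (A : Set G) * (B : Set G) = Set.univ)
    (hA : IsDihedralType A Y) (hB : IsDihedralType B X) (hNX : (A ⊔ N) ⊓ B ≤ X)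
    (hmaxX : ∀ M : Subgroup G, M.Normal → N < M → ¬ (A ⊔ M) ⊓ B ≤ X)
    (hmaxY : ∀ M : Subgroup G, M.Normal → N < M → ¬ (B ⊔ M) ⊓ A ≤ Y) :
    (X : Set G) * (A : Set G) ⊆ A * X := by
  by_cases hXN : X ≤ N
  · exact mul_subset_mul_of_le_normal hAB hNX hXN
  refine mul_subset_mul_of_map hAB hB.le hNX ?_
  have hABf := mul_eq_univ_map (QuotientGroup.mk'_surjective N) hAB
  have hBN : B ⊓ N ≤ X := fun b hb => hNX ⟨Subgroup.mem_sup_right hb.2, hb.1⟩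
  have hXf := map_inf_map_le hNX
  have hker := QuotientGroup.ker_mk' N
  have hBf := hB.map (hker.symm ▸ hXN) (hker.symm ▸ hBN)
  by_cases hYN : Y ≤ N
  · have := hA.isMulCommutative_map (hker.symm ▸ hYN)
    exact mul_subset_mul_of_isMulCommutative hABf hBf hXf
  have hAN : A ⊓ N ≤ Y := hA.inf_le_of_not_le fun hAN => hYN (hA.le.trans hAN)
  have hAf := hA.map (hker.symm ▸ hYN) (hker.symm ▸ hAN)
  by_cases hYf : A.map (QuotientGroup.mk' N) ⊓ B.map (QuotientGroup.mk' N) ≤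
      Y.map (QuotientGroup.mk' N)
  · exact (DihedralCore.of_inf_le hABf hAf hBf hXf hYf (fun M => exists_mul_mem_map hA.le hAN hmaxY)
      fun M => exists_mul_mem_map hB.le hBN hmaxX).mul_subset_mul
  · exact mul_subset_mul_swap hABf hAf hBf (fun h => absurd ((inf_comm _ _).trans_le h) hYf) hXf

/-- The normal subgroup to factor out is chosen maximal with respect to the condition for
`(A, B, X)`, and then, if possible, enlarged with respect to the condition for `(B, A, Y)`. -/
theorem mul_subset_mul_of_isDihedralType (hAB : (A : Set G) * (B : Set G) = Set.univ)
    (hA : IsDihedralType A Y) (hB : IsDihedralType B X) (hX : A ⊓ B ≤ X) :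
    (X : Set G) * (A : Set G) ⊆ A * X := by
  obtain ⟨N, -, hN, hNX, hmaxX⟩ := exists_maximal_normal ⊥ (sup_bot_eq A ▸ hX)
  by_cases hNY : (B ⊔ N) ⊓ A ≤ Y
  · obtain ⟨N', hNN', hN', hNY', hmaxY⟩ := exists_maximal_normal N hNY
    exact mul_subset_mul_swap hAB hA hB
      (fun _ => mul_subset_mul_of_maximal (mul_eq_univ_symm hAB) hB hA hNY' hmaxY
        fun M hM hlt => hmaxX M hM (hNN'.trans_lt hlt)) hX
  · exact mul_subset_mul_of_maximal hAB hA hB hNX hmaxX fun M _ hlt hMY =>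
      hNY ((inf_le_inf_right A (sup_le_sup_left hlt.le B)).trans hMY)

end Dihedral

section Ito

variable {G : Type*} [Group G] {A B : Subgroup G}

theorem mem_center_of_mul_eq_univ (hAB : (A : Set G) * (B : Set G) = Set.univ) {g : G}
    (hA : ∀ a ∈ A, Commute g a) (hB : ∀ b ∈ B, Commute g b) : g ∈ Subgroup.center G := by
  refine Subgroup.mem_center_iff.2 fun k => ?_
  obtain ⟨a, ha, b, hb, rfl⟩ := exists_mul_eq hAB k
  exact ((hA a ha).mul_right (hB b hb)).eq.symm

theorem isMulCommutative_of_mul_eq_univ [IsMulCommutative A] [IsMulCommutative B]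
    (hAB : (A : Set G) * (B : Set G) = Set.univ) (h : ∀ a ∈ A, ∀ b ∈ B, Commute a b) :
    IsMulCommutative G := by
  have mem_center (g : G) : g ∈ Subgroup.center G := by
    obtain ⟨a, ha, b, hb, rfl⟩ := exists_mul_eq hAB g
    exact mul_mem
      (mem_center_of_mul_eq_univ hAB (fun c hc => setLike_mul_comm ha hc) fun c hc => h a ha c hc)
      (mem_center_of_mul_eq_univ hAB (fun c hc => (h c hc b hb).symm)
        fun c hc => setLike_mul_comm hb hc)
  exact ⟨⟨fun g k => Subgroup.mem_center_iff.1 (mem_center k) g⟩⟩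

theorem normal_commutator_of_mul_eq_univ (hAB : (A : Set G) * (B : Set G) = Set.univ) :
    (⁅A, B⁆ : Subgroup G).Normal := by
  refine Subgroup.normalizer_eq_top_iff.1 (eq_top_iff.2 fun g _ => ?_)
  obtain ⟨a, ha, b, hb, rfl⟩ := exists_mul_eq hAB g
  exact mul_mem (Subgroup.normalizer_commutator_ge_left A B ha)
    (Subgroup.normalizer_commutator_ge_right A B hb)

theorem commutator_le_of_mul_eq_univ [IsMulCommutative A] [IsMulCommutative B]
    (hAB : (A : Set G) * (B : Set G) = Set.univ) : commutator G ≤ ⁅A, B⁆ := by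
  have := normal_commutator_of_mul_eq_univ hAB
  rw [← Subgroup.Normal.quotient_commutative_iff_commutator_le]
  refine isMulCommutative_of_mul_eq_univ
    (mul_eq_univ_map (QuotientGroup.mk'_surjective ⁅A, B⁆) hAB) ?_
  rintro _ ⟨a, ha, rfl⟩ _ ⟨b, hb, rfl⟩
  rw [← commutatorElement_eq_one_iff_commute, ← map_commutatorElement]
  exact (QuotientGroup.eq_one_iff _).2 (Subgroup.commutator_mem_commutator ha hb)

theorem isMulCommutative_commutator_of_mul_eq_univ [IsMulCommutative A] [IsMulCommutative B]
    (hAB : (A : Set G) * (B : Set G) = Set.univ) : IsMulCommutative (commutator G) := by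
  have hBA := mul_eq_univ_symm hAB
  have : IsMulCommutative (⁅A, B⁆ : Subgroup G) := by
    refine Subgroup.isMulCommutative_closure ?_
    rintro _ ⟨a, ha, b, hb, rfl⟩ _ ⟨c, hc, d, hd, rfl⟩
    have := commute_commutatorElement ha (A.inv_mem hc) hb (B.inv_mem hd)
      (hBA.ge trivial) (hAB.ge trivial)
    rwa [inv_inv, inv_inv] at this
  exact .of_setLike_mul_comm fun g hg k hk => setLike_mul_comm
    (commutator_le_of_mul_eq_univ hAB hg) (commutator_le_of_mul_eq_univ hAB hk)

end Ito

section CommutatorHom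

variable {G : Type*} [Group G] {X Y T V : Subgroup G}

theorem eq_of_sup_eq_top [V.Normal] (hVT : V ≤ T) (hXT : X ⊓ T = ⊥) (hXV : X ⊔ V = ⊤) :
    V = T := by
  refine le_antisymm hVT fun t ht => ?_
  obtain ⟨x, hx, v, hv, rfl⟩ :=
    Subgroup.mem_sup_of_normal_right.1 (hXV ▸ Subgroup.mem_top t)
  have hx1 : x ∈ X ⊓ T := ⟨hx, (T.mul_mem_cancel_right (hVT hv)).1 ht⟩
  rw [hXT, Subgroup.mem_bot] at hx1
  rwa [hx1, one_mul]

variable [T.Normal]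

/-- Commutation with a fixed element `w`, as a homomorphism on an abelian normal subgroup `T`. -/
def commutatorHom (T : Subgroup G) [T.Normal] [IsMulCommutative T] (w : G) : T →* G where
  toFun t := ⁅w, (t : G)⁆
  map_one' := commutatorElement_one_right w
  map_mul' s t := by
    have hmem : ⁅w, (t : G)⁆ ∈ T :=
      Subgroup.commutator_le_right ⊤ T (Subgroup.commutator_mem_commutator trivial t.2)
    rw [Subgroup.coe_mul, commutatorElement_mul_right_eq_mul_conj, mul_assoc, mul_assoc,
      ← mul_assoc (s : G), setLike_mul_comm s.2 hmem, mul_inv_cancel_right]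

theorem range_commutatorHom_le [IsMulCommutative T] (w : G) : (commutatorHom T w).range ≤ T := by
  rintro _ ⟨t, rfl⟩
  exact Subgroup.commutator_le_right ⊤ T (Subgroup.commutator_mem_commutator trivial t.2)

theorem mem_map_ker_commutatorHom [IsMulCommutative T] {w t : G} :
    t ∈ (commutatorHom T w).ker.map T.subtype ↔ t ∈ T ∧ Commute w t := by
  refine ⟨?_, fun ⟨ht, hwt⟩ => ⟨⟨t, ht⟩, commutatorElement_eq_one_iff_commute.2 hwt, rfl⟩⟩
  rintro ⟨t, ht, rfl⟩
  exact ⟨t.2, commutatorElement_eq_one_iff_commute.1 ht⟩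

theorem normal_of_sup_eq_top [IsMulCommutative T] (hXT : X ⊔ T = ⊤) (hVT : V ≤ T)
    (hV : ∀ x ∈ X, ∀ v ∈ V, x * v * x⁻¹ ∈ V) : V.Normal := by
  refine ⟨fun v hv g => ?_⟩
  obtain ⟨x, hx, t, ht, rfl⟩ :=
    Subgroup.mem_sup_of_normal_right.1 (hXT ▸ Subgroup.mem_top g)
  rw [show x * t * v * (x * t)⁻¹ = x * (t * v * t⁻¹) * x⁻¹ by group,
    setLike_mul_comm ht (hVT hv), mul_inv_cancel_right]
  exact hV x hx v hv

theorem normal_range_commutatorHom [IsMulCommutative T] (hXT : X ⊔ T = ⊤) {w : G}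
    (hw : ∀ x ∈ X, Commute w x) : (commutatorHom T w).range.Normal := by
  refine normal_of_sup_eq_top hXT (range_commutatorHom_le w) ?_
  rintro x hx _ ⟨t, rfl⟩
  refine ⟨⟨x * t * x⁻¹, ‹T.Normal›.conj_mem t t.2 x⟩, ?_⟩
  change ⁅w, x * t * x⁻¹⁆ = x * ⁅w, (t : G)⁆ * x⁻¹
  rw [conjugate_commutatorElement, ← (hw x hx).eq, mul_inv_cancel_right]

theorem normal_map_ker_commutatorHom [IsMulCommutative T] (hXT : X ⊔ T = ⊤) {w : G}
    (hw : ∀ x ∈ X, Commute w x) : ((commutatorHom T w).ker.map T.subtype).Normal := by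
  refine normal_of_sup_eq_top hXT (Subgroup.map_subtype_le _) fun x hx t ht => ?_
  obtain ⟨htT, hwt⟩ := mem_map_ker_commutatorHom.1 ht
  exact mem_map_ker_commutatorHom.2 ⟨‹T.Normal›.conj_mem t htT x,
    ((hw x hx).mul_right hwt).mul_right (hw x hx).inv_right⟩

/-- `w` is conjugate to the element of `Y` in its coset of `T`. -/
theorem mem_of_le_range_commutatorHom [IsMulCommutative T]
    (hXY : (X : Set G) * (Y : Set G) = Set.univ) (hYT : Y ⊔ T = ⊤) {w : G}
    (hw : ∀ x ∈ X, Commute w x) (hT : T ≤ (commutatorHom T w).range) : w ∈ Y := by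
  obtain ⟨t, ht, y, hy, hty⟩ :=
    Subgroup.mem_sup_of_normal_left.1 (sup_comm Y T ▸ hYT ▸ Subgroup.mem_top w)
  obtain ⟨u, hu : ⁅w, (u : G)⁆ = t⟩ := hT ht
  have hyu : y = u * w * (u : G)⁻¹ := by
    rw [← mul_right_inj t, hty, ← hu, commutatorElement_def]
    group
  obtain ⟨z, hz, x, hx, hzx⟩ := exists_mul_eq' hXY (u : G)
  have hwy : w = z⁻¹ * y * z := by
    rw [hyu, ← hzx, show z⁻¹ * (z * x * w * (z * x)⁻¹) * z = x * w * x⁻¹ by group,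
      ← (hw x hx).eq, mul_inv_cancel_right]
  exact hwy ▸ Y.mul_mem (Y.mul_mem (Y.inv_mem hz) hy) hz

end CommutatorHom

namespace IsQuasicyclic

variable {G : Type*} [Group G] {X Y T : Subgroup G}

/-- With `y = u ^ n` and `w ^ n = 1`, the central commutator `⁅w, u⁆` satisfies `⁅w, u⁆ ^ n = 1`,
so that `w` commutes with `u ^ n`. -/
theorem commute_of_commutatorElement_mem_center (hY : IsQuasicyclic Y) {w : G}
    (hw : IsOfFinOrder w) (h : ∀ y ∈ Y, ⁅w, y⁆ ∈ Subgroup.center G) {y : G} (hy : y ∈ Y) :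
    Commute w y := by
  obtain ⟨n, hn, hwn⟩ := isOfFinOrder_iff_pow_eq_one.1 hw
  obtain ⟨u, hu, rfl⟩ := hY.exists_pow_eq hn hy
  have hcomm (g : G) : Commute ⁅w, u⁆ g := (Subgroup.mem_center_iff.1 (h u hu) g).symm
  have hc : ⁅w, u⁆ ^ n = 1 := by
    have : (⁅w, u⁆⁻¹ * w) ^ n = 1 := by
      rw [commutatorElement_inv, commutatorElement_def, inv_mul_cancel_right, conj_pow, hwn,
        mul_one, mul_inv_cancel]
    rwa [(hcomm w).inv_left.mul_pow, hwn, mul_one, inv_pow, inv_eq_one] at this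
  refine mul_inv_eq_iff_eq_mul.1 ?_
  calc w * u ^ n * w⁻¹ = (⁅w, u⁆ * u) ^ n := by
        rw [← conj_pow, commutatorElement_def, inv_mul_cancel_right]
    _ = u ^ n := by rw [(hcomm u).mul_pow, hc, one_mul]

theorem sup_eq_top_of_infinite (hY : IsQuasicyclic Y) (hXY : (X : Set G) * (Y : Set G) = Set.univ)
    (hXT : ((X ⊓ T : Subgroup G) : Set G).Finite) (hT : (T : Set G).Infinite) : X ⊔ T = ⊤ := by
  have hYXT : Y ≤ X ⊔ T := by
    by_contra hle
    obtain ⟨y, hy, hyXT⟩ := SetLike.not_le_iff_exists.1 hle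
    exact hT (finite_of_finite_inf (mul_eq_univ_symm hXY) le_sup_right le_sup_left
      (hY.finite_of_notMem inf_le_left hy fun h => hyXT h.2) hXT)
  refine eq_top_iff.2 fun g _ => ?_
  obtain ⟨x, hx, y, hy, rfl⟩ := exists_mul_eq hXY g
  exact mul_mem (Subgroup.mem_sup_left hx) (hYXT hy)

theorem mem_center_of_mem_normal (hX : IsQuasicyclic X) (hY : IsQuasicyclic Y)
    (hXY : (X : Set G) * (Y : Set G) = Set.univ) [T.Normal] [IsMulCommutative T] {w : G}
    (hw : w ∈ X) (hwT : w ∈ T) : w ∈ Subgroup.center G := by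
  refine mem_center_of_mul_eq_univ hXY (fun x hx => hX.commute hw hx) fun y hy => ?_
  set M := Subgroup.normalClosure {w}
  have hwM : w ∈ M := Subgroup.subset_normalClosure rfl
  have hMT : M ≤ T := Subgroup.normalClosure_le_normal (Set.singleton_subset_iff.2 hwT)
  have : IsMulCommutative M :=
    .of_setLike_mul_comm fun m hm n hn => setLike_mul_comm (hMT hm) (hMT hn)
  by_cases hM : (M : Set G).Finite
  · have : Finite M := hM
    exact (hY.commute_of_finite_normal hy hwM).symm
  · obtain ⟨n, hn, hwn⟩ := isOfFinOrder_iff_pow_eq_one.1 (hX.isOfFinOrder_of_mem hw)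
    have hXM : ((X ⊓ M : Subgroup G) : Set G).Finite :=
      (hX.finite_setOf_pow_eq_one hn).subset
        fun m hm => ⟨hm.1, pow_eq_one_of_mem_normalClosure hwn hm.2⟩
    obtain ⟨x, hx, m, hm, rfl⟩ := Subgroup.mem_sup_of_normal_right.1
      (hY.sup_eq_top_of_infinite hXY hXM hM ▸ Subgroup.mem_top y)
    exact (hX.commute hw hx).mul_right (setLike_mul_comm hwM hm)

theorem mem_center_of_finite_commutator (hX : IsQuasicyclic X) (hY : IsQuasicyclic Y)
    (hXY : (X : Set G) * (Y : Set G) = Set.univ) [Finite (commutator G)] {w : G} (hw : w ∈ X) :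
    w ∈ Subgroup.center G := by
  refine mem_center_of_mul_eq_univ hXY (fun x hx => hX.commute hw hx) fun y hy => ?_
  refine hY.commute_of_commutatorElement_mem_center (hX.isOfFinOrder_of_mem hw) (fun y _ => ?_) hy
  have hmem : ⁅w, y⁆ ∈ commutator G := Subgroup.commutator_mem_commutator trivial trivial
  exact mem_center_of_mul_eq_univ hXY
    (fun x hx => (hX.commute_of_finite_normal hx hmem).symm)
    fun y hy => (hY.commute_of_finite_normal hy hmem).symm

/-- Either the kernel or the image of `t ↦ ⁅w, t⁆` on `T` is infinite, hence all of `T`. -/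
theorem mem_center_or_mem_of_infinite (hX : IsQuasicyclic X) (hY : IsQuasicyclic Y)
    (hXY : (X : Set G) * (Y : Set G) = Set.univ) [T.Normal] [IsMulCommutative T]
    (hT : (T : Set G).Infinite) (hXT : X ⊓ T = ⊥) (hYT : Y ⊓ T = ⊥) {w : G} (hw : w ∈ X) :
    w ∈ Subgroup.center G ∨ w ∈ Y := by
  have hwX (x : G) (hx : x ∈ X) : Commute w x := hX.commute hw hx
  have finite_bot : ((⊥ : Subgroup G) : Set G).Finite := Set.finite_singleton 1
  have hXTtop : X ⊔ T = ⊤ := hY.sup_eq_top_of_infinite hXY (hXT ▸ finite_bot) hT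
  have hYTtop : Y ⊔ T = ⊤ :=
    hX.sup_eq_top_of_infinite (mul_eq_univ_symm hXY) (hYT ▸ finite_bot) hT
  have eq_of_infinite {V : Subgroup G} [V.Normal] (hVT : V ≤ T) (hV : (V : Set G).Infinite) :
      V = T :=
    eq_of_sup_eq_top hVT hXT <| hY.sup_eq_top_of_infinite hXY
      ((hXT ▸ finite_bot).subset (inf_le_inf_left X hVT)) hV
  set φ := commutatorHom T w
  have := normal_range_commutatorHom hXTtop hwX
  have := normal_map_ker_commutatorHom hXTtop hwX
  by_cases hker : (φ.ker.map T.subtype : Set G).Finite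
  · right
    have hrange : φ.range = T := eq_of_infinite (range_commutatorHom_le w) fun hfin =>
      hT (φ.finite_iff_finite_ker_range.2
        ⟨(hker.of_finite_image T.subtype_injective.injOn).to_subtype, hfin⟩)
    exact mem_of_le_range_commutatorHom hXY hYTtop hwX hrange.ge
  · left
    have hkerT : φ.ker.map T.subtype = T := eq_of_infinite (Subgroup.map_subtype_le _) hker
    refine Subgroup.mem_center_iff.2 fun g => ?_
    obtain ⟨x, hx, t, ht, rfl⟩ :=
      Subgroup.mem_sup_of_normal_right.1 (hXTtop ▸ Subgroup.mem_top g)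
    exact ((hwX x hx).mul_right (mem_map_ker_commutatorHom.1 (hkerT.ge ht)).2).eq.symm

theorem exists_mem_center (hX : IsQuasicyclic X) (hY : IsQuasicyclic Y)
    (hXY : (X : Set G) * (Y : Set G) = Set.univ) :
    ∃ g ∈ Subgroup.center G, g ≠ 1 ∧ (g ∈ X ∨ g ∈ Y) := by
  have hYX := mul_eq_univ_symm hXY
  have := hX.isMulCommutative
  have := hY.isMulCommutative
  have := isMulCommutative_commutator_of_mul_eq_univ hXY
  by_cases hXT : X ⊓ commutator G = ⊥
  swap
  · obtain ⟨⟨w, hw, hwT⟩, hw1⟩ := Subgroup.ne_bot_iff_exists_ne_one.1 hXT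
    exact ⟨w, hX.mem_center_of_mem_normal hY hXY hw hwT, fun h => hw1 (Subtype.ext h), .inl hw⟩
  by_cases hYT : Y ⊓ commutator G = ⊥
  swap
  · obtain ⟨⟨w, hw, hwT⟩, hw1⟩ := Subgroup.ne_bot_iff_exists_ne_one.1 hYT
    exact ⟨w, hY.mem_center_of_mem_normal hX hYX hw hwT, fun h => hw1 (Subtype.ext h), .inr hw⟩
  obtain ⟨w, hw, hw1⟩ := hX.infinite_coe.nontrivial.exists_ne 1
  refine ⟨w, ?_, hw1, .inl hw⟩
  by_cases hT : (commutator G : Set G).Finite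
  · have : Finite (commutator G) := hT
    exact hX.mem_center_of_finite_commutator hY hXY hw
  · refine (hX.mem_center_or_mem_of_infinite hY hXY hT hXT hYT hw).elim id fun hwY => ?_
    exact mem_center_of_mul_eq_univ hXY (fun x hx => hX.commute hw hx)
      fun y hy => hY.commute hwY hy

theorem isMulCommutative_of_mul_eq_univ (hX : IsQuasicyclic X) (hY : IsQuasicyclic Y)
    (hXY : (X : Set G) * (Y : Set G) = Set.univ) : IsMulCommutative G := by
  have := hX.isMulCommutative
  have := hY.isMulCommutative
  refine _root_.isMulCommutative_of_mul_eq_univ hXY fun x hx y hy => ?_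
  set f := QuotientGroup.mk' (Subgroup.center G)
  have hker : f.ker = Subgroup.center G := QuotientGroup.ker_mk' _
  by_cases hXZ : X ≤ f.ker
  · exact (Subgroup.mem_center_iff.1 (hker.le (hXZ hx)) y).symm
  by_cases hYZ : Y ≤ f.ker
  · exact Subgroup.mem_center_iff.1 (hker.le (hYZ hy)) x
  have mem_center {X Y : Subgroup G} (hX : IsQuasicyclic X) (hY : IsQuasicyclic Y)
      (hXY : (X : Set G) * (Y : Set G) = Set.univ) {w : G} (hw : w ∈ X)
      (hfw : f w ∈ Subgroup.center (G ⧸ Subgroup.center G)) : w ∈ f.ker := by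
    refine hker.ge (mem_center_of_mul_eq_univ hXY (fun x hx => hX.commute hw hx) fun y hy => ?_)
    refine hY.commute_of_commutatorElement_mem_center (hX.isOfFinOrder_of_mem hw) (fun y _ => ?_) hy
    rw [← hker, MonoidHom.mem_ker, map_commutatorElement, commutatorElement_eq_one_iff_commute]
    exact (Subgroup.mem_center_iff.1 hfw (f y)).symm
  obtain ⟨_, hcenter, hne, ⟨w, hw, rfl⟩ | ⟨w, hw, rfl⟩⟩ := (hX.map hXZ).exists_mem_center
    (hY.map hYZ) (mul_eq_univ_map (QuotientGroup.mk'_surjective _) hXY)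
  · exact absurd (mem_center hX hY hXY hw hcenter) hne
  · exact absurd (mem_center hY hX (mul_eq_univ_symm hXY) hw hcenter) hne

end IsQuasicyclic

section Main

variable {G : Type*} [Group G] {A B X : Subgroup G}

theorem isMulCommutative_or_exists_isDihedralType (h : IsAbelianOrQuasicyclicIndexTwo A) :
    IsMulCommutative A ∨ ∃ Y, IsDihedralType A Y := by
  refine or_iff_not_imp_left.2 fun hA => ?_
  obtain ⟨Y, hY, hY2⟩ := h.resolve_left hA
  have hYA : (Y.map A.subtype).subgroupOf A = Y :=
    Subgroup.comap_map_eq_self_of_injective A.subtype_injective Y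
  have hker : ¬ Y ≤ A.subtype.ker := by
    rw [A.ker_subtype, le_bot_iff]
    rintro rfl
    exact hY.infinite_coe (Set.finite_singleton 1)
  exact ⟨Y.map A.subtype, .of_not_isMulCommutative (hY.map hker) (Subgroup.map_subtype_le Y)
    ((congrArg Subgroup.index hYA).trans hY2) hA⟩

theorem mul_eq_univ_of_not_inf_le (hAB : (A : Set G) * (B : Set G) = Set.univ)
    (hB : IsDihedralType B X) (hX : ¬ A ⊓ B ≤ X) : (A : Set G) * (X : Set G) = Set.univ := by
  obtain ⟨c, ⟨hcA, hcB⟩, hcX⟩ := SetLike.not_le_iff_exists.1 hX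
  refine Set.eq_univ_of_forall fun g => ?_
  obtain ⟨a, ha, b, hb, rfl⟩ := exists_mul_eq hAB g
  by_cases hbX : b ∈ X
  · exact ⟨a, ha, b, hbX, rfl⟩
  · exact ⟨a * c, A.mul_mem ha hcA, c⁻¹ * b,
      hB.mul_mem (B.inv_mem hcB) (mt X.inv_mem_iff.1 hcX) hb hbX, by group⟩

theorem mul_subset_mul (hAB : (A : Set G) * (B : Set G) = Set.univ)
    (hA : IsMulCommutative A ∨ ∃ Y, IsDihedralType A Y) (hB : IsDihedralType B X) :
    (X : Set G) * (A : Set G) ⊆ A * X := by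
  by_cases hX : A ⊓ B ≤ X
  · rcases hA with hA | ⟨Y, hA⟩
    · exact mul_subset_mul_of_isMulCommutative hAB hB hX
    · exact mul_subset_mul_of_isDihedralType hAB hA hB hX
  · exact (mul_eq_univ_of_not_inf_le hAB hB hX).symm ▸ Set.subset_univ _

theorem index_sup_eq_one (hAB : (A : Set G) * (B : Set G) = Set.univ) (hB : IsDihedralType B X)
    (hX : ¬ A ⊓ B ≤ X) : (A ⊔ X).index = 1 := by
  refine Subgroup.index_eq_one.2 (eq_top_iff.2 fun g _ => ?_)
  obtain ⟨a, ha, x, hx, rfl⟩ := exists_mul_eq (mul_eq_univ_of_not_inf_le hAB hB hX) g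
  exact Subgroup.mul_mem_sup ha hx

theorem index_sup_eq_two (hAB : (A : Set G) * (B : Set G) = Set.univ) (hB : IsDihedralType B X)
    (h : (X : Set G) * (A : Set G) ⊆ A * X) (hX : A ⊓ B ≤ X) : (A ⊔ X).index = 2 := by
  obtain ⟨y, hy, hyX⟩ := hB.exists_notMem
  refine Subgroup.index_eq_two_iff_exists_notMem_and.2 ⟨y, fun hyM => hyX ?_, fun g => ?_⟩
  · rw [← SetLike.mem_coe, coe_sup_eq_mul h] at hyM
    obtain ⟨a, ha, x, hx, rfl⟩ := hyM
    exact X.mul_mem (hX ⟨ha, (B.mul_mem_cancel_right (hB.le hx)).1 hy⟩) hx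
  · obtain ⟨a, ha, b, hb, rfl⟩ := exists_mul_eq hAB g
    by_cases hbX : b ∈ X
    · exact .inr (Subgroup.mul_mem_sup ha hbX)
    · exact .inl (mul_assoc a b y ▸ Subgroup.mul_mem_sup ha (hB.mul_mem hb hbX hy hyX))

theorem commutator_le_of_index_two {H : Subgroup G} (hH : H.index = 2) : commutator G ≤ H := by
  refine Subgroup.commutator_le.2 fun g _ k _ => ?_
  simp only [commutatorElement_def, Subgroup.mul_mem_iff_of_index_two hH, inv_mem_iff]
  tauto

theorem commutator_le_sup (hAB : (A : Set G) * (B : Set G) = Set.univ) (hB : IsDihedralType B X)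
    (h : (X : Set G) * (A : Set G) ⊆ A * X) : commutator G ≤ A ⊔ X := by
  by_cases hX : A ⊓ B ≤ X
  · exact commutator_le_of_index_two (index_sup_eq_two hAB hB h hX)
  · exact (Subgroup.index_eq_one.1 (index_sup_eq_one hAB hB hX)).symm ▸ le_top

theorem isMetabelian_iff : IsMetabelian G ↔ IsMulCommutative (commutator G) := by
  rw [IsMetabelian, derivedSeries_succ, derivedSeries_one, Subgroup.commutator_self_eq_bot_iff]

theorem IsQuasicyclic.isMulCommutative_sup {Y : Subgroup G} (hX : IsQuasicyclic X)
    (hY : IsQuasicyclic Y) (h : (Y : Set G) * (X : Set G) ⊆ X * Y) :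
    IsMulCommutative (X ⊔ Y : Subgroup G) :=
  (hX.subgroupOf le_sup_left).isMulCommutative_of_mul_eq_univ (hY.subgroupOf le_sup_right)
    (subgroupOf_mul_subgroupOf_eq_univ (coe_sup_eq_mul h).symm)

theorem isMetabelian_of_isQuasicyclic (hAX : (A : Set G) * (X : Set G) = Set.univ)
    (hA : IsMulCommutative A ∨ ∃ Y, IsDihedralType A Y) (hX : IsQuasicyclic X) :
    IsMetabelian G := by
  rw [isMetabelian_iff]
  have hXc := hX.isMulCommutative
  rcases hA with hA | ⟨Y, hA⟩
  · exact isMulCommutative_commutator_of_mul_eq_univ hAX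
  · have hXA := mul_eq_univ_symm hAX
    have hYX := mul_subset_mul hXA (.inl hXc) hA
    have := hX.isMulCommutative_sup hA.isQuasicyclic hYX
    have hle := commutator_le_sup hXA hA hYX
    exact .of_setLike_mul_comm fun g hg k hk => setLike_mul_comm (hle hg) (hle hk)

theorem isMetabelian_sup (hA : IsMulCommutative A ∨ ∃ Y, IsDihedralType A Y)
    (hX : IsQuasicyclic X) (h : (X : Set G) * (A : Set G) ⊆ A * X) :
    IsMetabelian (A ⊔ X : Subgroup G) := by
  refine isMetabelian_of_isQuasicyclic (subgroupOf_mul_subgroupOf_eq_univ (coe_sup_eq_mul h).symm)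
    ?_ (hX.subgroupOf le_sup_right)
  rcases hA with hA | ⟨Y, hA⟩
  · exact .inl inferInstance
  · exact .inr ⟨_, hA.subgroupOf le_sup_left⟩

theorem derivedSeries_succ_le_map {M : Subgroup G} (hM : commutator G ≤ M) (n : ℕ) :
    derivedSeries G (n + 1) ≤ (derivedSeries M n).map M.subtype := by
  induction n with
  | zero => rwa [derivedSeries_one, derivedSeries_zero M, ← MonoidHom.range_eq_map, M.range_subtype]
  | succ n ih =>
    rw [derivedSeries_succ, derivedSeries_succ M n, Subgroup.map_commutator]
    exact Subgroup.commutator_mono ih ih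

theorem derivedSeries_three_eq_bot_of_isDihedralType
    (hAB : (A : Set G) * (B : Set G) = Set.univ)
    (hA : IsMulCommutative A ∨ ∃ Y, IsDihedralType A Y) (hB : IsDihedralType B X) :
    derivedSeries G 3 = ⊥ := by
  have h := mul_subset_mul hAB hA hB
  have hmet : derivedSeries (A ⊔ X : Subgroup G) 2 = ⊥ := isMetabelian_sup hA hB.isQuasicyclic h
  have hle := derivedSeries_succ_le_map (commutator_le_sup hAB hB h) 2
  rwa [hmet, Subgroup.map_bot, le_bot_iff] at hle

theorem derivedSeries_three_eq_bot (hAB : (A : Set G) * (B : Set G) = Set.univ)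
    (hA : IsMulCommutative A ∨ ∃ Y, IsDihedralType A Y)
    (hB : IsMulCommutative B ∨ ∃ X, IsDihedralType B X) : derivedSeries G 3 = ⊥ := by
  rcases hB with hBc | ⟨X, hB⟩
  · rcases hA with hAc | ⟨Y, hA⟩
    · have hmet : derivedSeries G 2 = ⊥ :=
        isMetabelian_iff.2 (isMulCommutative_commutator_of_mul_eq_univ hAB)
      rw [derivedSeries_succ, hmet, Subgroup.commutator_bot_left]
    · exact derivedSeries_three_eq_bot_of_isDihedralType (mul_eq_univ_symm hAB) (.inl hBc) hA
  · exact derivedSeries_three_eq_bot_of_isDihedralType hAB hA hB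

end Main

theorem theorem1p1 {G : Type*} [Group G] (A B : Subgroup G)
    (hAB : (A : Set G) * (B : Set G) = Set.univ)
    (hA : IsAbelianOrQuasicyclicIndexTwo A) (hB : IsAbelianOrQuasicyclicIndexTwo B) :
    (Group.IsSolvable G ∧ derivedSeries G 3 = ⊥) ∧
    (¬ IsMulCommutative B →
      ∀ X : Subgroup G, X ≤ B → IsQuasicyclic X →
        (A : Set G) * (X : Set G) = (X : Set G) * (A : Set G) ∧
        ∃ M : Subgroup G, (M : Set G) = (A : Set G) * (X : Set G) ∧
          IsMetabelian M ∧
          (A ⊓ B ≤ X → M.index = 2) ∧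
          (¬ A ⊓ B ≤ X → M.index = 1)) := by
  have hA' := isMulCommutative_or_exists_isDihedralType hA
  have hB' := isMulCommutative_or_exists_isDihedralType hB
  have hder := derivedSeries_three_eq_bot hAB hA' hB'
  refine ⟨⟨⟨⟨3, hder⟩⟩, hder⟩, fun hBc X hXB hX => ?_⟩
  obtain ⟨X', hBX⟩ := hB'.resolve_left hBc
  obtain rfl := hBX.eq_of_isQuasicyclic hX hXB
  have hXA := mul_subset_mul hAB hA' hBX
  exact ⟨(mul_comm_of_subset hXA).symm, A ⊔ X, coe_sup_eq_mul hXA, isMetabelian_sup hA' hX hXA,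
    index_sup_eq_two hAB hBX hXA, index_sup_eq_one hAB hBX⟩
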